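/- Let $G$ be a finite simple $(3,4)$-biregular bigraph, that is, a finite simple bipartite graph with a bipartition $(Y,X)$ such that every vertex in $Y$ has degree $3$ and every vertex in $X$ has degree $4$. Then $G$ has a path factor in which the endpoints of each path have degree $3$ in $G$; that is, $G$ has a spanning subgraph $F$ such that every connected component of $F$ is a path of length at least $1$ and both endpoints of each of these paths have degree $3$ in $G$. Moreover, there is a polynomial-time algorithm which constructs such a path factor: a single deterministic program that, given the number $n$ of vertices and the adjacency matrix of any such graph $G$ on the vertex set $\{0,\dots,n-1\}$, outputs the adjacency matrix of such an $F$ after a number of steps bounded by a polynomial in $n$. (Programs operate on a random access memory and use assignments, conditionals and while-loops; the arithmetic is addition and subtraction of $1$ and comparison, each elementary step having unit cost.) -/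

import Mathlib

/-! ### Biregular bigraphs and path factors -/

/-- `G` is an `(a, b)`-biregular bigraph: it is bipartite with bipartition `(Y, X)`, every vertex
of `Y` has degree `a` and every vertex of `X` has degree `b`. -/
def IsBiregularBigraph {V : Type*} (a b : ℕ) (G : SimpleGraph V) : Prop :=
  ∃ Y X : Set V, G.IsBipartiteWith Y X ∧ Y ∪ X = Set.univ ∧
    (∀ y ∈ Y, (G.neighborSet y).encard = a) ∧ (∀ x ∈ X, (G.neighborSet x).encard = b)

/-- `F` is a path factor of `G`: a spanning subgraph (same vertex set) each of whose connected
components is a path of some length `l ≥ 1` (so with `l + 1` vertices). -/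
def IsPathFactor {V : Type*} (G F : SimpleGraph V) : Prop :=
  F ≤ G ∧ ∀ C : F.ConnectedComponent,
    ∃ l : ℕ, 1 ≤ l ∧ Nonempty (SimpleGraph.pathGraph (l + 1) ≃g C.toSimpleGraph)

/-- Whenever a component of `F` is a path, both endpoints of that path have degree `d` in `G`. -/
def PathEndpointsHaveDegree {V : Type*} (d : ℕ) (G F : SimpleGraph V) : Prop :=
  ∀ (C : F.ConnectedComponent) (l : ℕ) (f : SimpleGraph.pathGraph (l + 1) ≃g C.toSimpleGraph),
    (G.neighborSet (f 0 : V)).encard = d ∧ (G.neighborSet (f (Fin.last l) : V)).encard = d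

/-! ### A machine model with a step count

Deterministic programs on a random access memory, organised into arrays with two indices. The only
arithmetic is adding or subtracting one, so that a number held in memory after `t` steps exceeds
the initial numbers and the constants of the program by at most a constant times `t`, and unit
cost is realistic: up to a polynomial the step count agrees with Turing machine time. -/

namespace ArrayMachine

/-- The memory: `M a i j` is the entry `(i, j)` of the array number `a`. -/
abbrev Memory : Type := ℕ → ℕ → ℕ → ℕ

/-- Expressions: constants, array entries, successor and (truncated) predecessor. The number of the
array is fixed in the program, the indices are computed. -/
inductive Expr : Type
  | lit (c : ℕ)
  | get (a : ℕ) (i j : Expr)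
  | succ (e : Expr)
  | pred (e : Expr)

/-- Value of an expression in a memory. -/
def Expr.eval (M : Memory) : Expr → ℕ
  | .lit c => c
  | .get a i j => M a (i.eval M) (j.eval M)
  | .succ e => e.eval M + 1
  | .pred e => e.eval M - 1

/-- Tests. -/
inductive Test : Type
  | eq (e f : Expr)
  | lt (e f : Expr)

/-- Truth value of a test in a memory. -/
def Test.eval (M : Memory) : Test → Bool
  | .eq e f => decide (e.eval M = f.eval M)
  | .lt e f => decide (e.eval M < f.eval M)

/-- Programs. -/
inductive Program : Type
  | skip
  | store (a : ℕ) (i j e : Expr)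
  | seq (p q : Program)
  | ite (b : Test) (p q : Program)
  | loop (b : Test) (p : Program)

/-- The memory after writing the value `v` to the entry `(i, j)` of the array `a`. -/
def Memory.write (M : Memory) (a i j v : ℕ) : Memory :=
  fun a' i' j' => if a' = a ∧ i' = i ∧ j' = j then v else M a' i' j'

/-- A configuration: the list of programs still to be executed, and the memory. -/
abbrev Config : Type := List Program × Memory

/-- One step of computation; `loop b p` repeats `p` as long as `b` holds. -/
def step : Config → Config
  | ([], M) => ([], M)
  | (.skip :: k, M) => (k, M)
  | (.store a i j e :: k, M) => (k, M.write a (i.eval M) (j.eval M) (e.eval M))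
  | (.seq p q :: k, M) => (p :: q :: k, M)
  | (.ite b p q :: k, M) => (cond (b.eval M) (p :: k) (q :: k), M)
  | (.loop b p :: k, M) => (cond (b.eval M) (p :: .loop b p :: k) k, M)

/-- Started on the memory `M`, the program `p` halts within `t` steps with the memory `M'`. -/
def HaltsWithin (p : Program) (M : Memory) (t : ℕ) (M' : Memory) : Prop :=
  step^[t] ([p], M) = ([], M')

open Classical in
/-- The input for a graph `G` on `{0, …, n - 1}`: array `0` holds the adjacency matrix, entry
`(0, 0)` of array `1` holds `n`, and every other entry of the memory is `0`. -/
noncomputable def graphInput {n : ℕ} (G : SimpleGraph (Fin n)) : Memory := fun a i j =>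
  if a = 0 then (if ∃ (hi : i < n) (hj : j < n), G.Adj ⟨i, hi⟩ ⟨j, hj⟩ then 1 else 0)
  else if a = 1 ∧ i = 0 ∧ j = 0 then n
  else 0

open Classical in
/-- Array `2` of the memory `M` holds the adjacency matrix of `F` in its entries `(i, j)` with
`i, j < n`. -/
def IsGraphOutput {n : ℕ} (M : Memory) (F : SimpleGraph (Fin n)) : Prop :=
  ∀ i j : Fin n, M 2 i j = if F.Adj i j then 1 else 0

/-- Some program, the same for all inputs, constructs from each graph `G` on `{0, …, n - 1}` with
property `P` a graph `F` on the same vertices with `R G F`, in a number of steps bounded by a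
polynomial in `n`. -/
def PolyTimeConstructible (P : ∀ {n : ℕ}, SimpleGraph (Fin n) → Prop)
    (R : ∀ {n : ℕ}, SimpleGraph (Fin n) → SimpleGraph (Fin n) → Prop) : Prop :=
  ∃ (p : Program) (T : Polynomial ℕ), ∀ (n : ℕ) (G : SimpleGraph (Fin n)), P G →
    ∃ (M : Memory) (F : SimpleGraph (Fin n)),
      HaltsWithin p (graphInput G) (T.eval n) M ∧ IsGraphOutput M F ∧ R G F

end ArrayMachine

/-! The aim is a linear forest `F` in `G` with degree 2 at every vertex of degree 4 and degree at
least 1 everywhere (`IsWanted`). The components of such an `F` are nontrivial paths, and a path end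
has degree 1 in `F`, hence degree 3 in `G` (`IsWanted.isPathFactor`). `F` is grown by augmentations:
`phaseThree` gives each vertex of degree 3 one edge, and each of two runs of `phaseFour` adds an
edge at every vertex of degree 4 that has fewer than two. An augmentation (`Gained`) raises the
degree at one vertex `v₀` of the class `A` being served, keeps the other degrees in `A`, and
isolates no vertex outside `A`.

An augmentation is found by an alternating search. Since acyclicity must survive, each reached
vertex `v ∈ D` carries its own linear forest `S v`, whose degrees on `A` are those of `F` plus one
at `v₀` minus one at `v`. If an edge `vp` can be added to `S v`, the search ends (`Gain`). Otherwise
deleting some edge `qw` may make room for `vp`, and the missing edge passes to `w` (`Move`).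

The search cannot get stuck, by counting. Let `old` and `new` be the numbers of edges of `G` at `D`
inside and outside `F`. When `A` is the class of degree 4, `old + new = 4|D|` and `old < 2|D|`, so
`new > old`. Seen from the other side, where degrees are 3, a vertex can have more new than old
edges only if it is in `Closed`, and then by at most one; a vertex in `Full` has at least one more
old than new. Hence `new ≤ old` as soon as `|Closed| ≤ |Full|`. This inequality is secured by
preferring moves that stay inside a component. They preserve that component (`reachable_exchange`),
so a stage of such moves works on one path starting at a root `r`. It can newly close only the far
end of that path, and if it does, it reaches all vertices of `A` on the path; then the neighbour of
`r` on the path becomes full, and it was not full before because `r` is new (`Stage.saturated`).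
When `A` is the class of degree 3, every `v ∈ D` is isolated in `S v`, no vertex is closed, and the
count is immediate (`State.exists_of_degree_three`).

Every unsuccessful round enlarges `D`, so `n` rounds suffice. The program uses only loops up to `n`;
a polynomial bound is read off its syntax (`Cmd.runs`), and its correctness follows from loop
invariants (`Cmd.den_rep`). Existence on an arbitrary finite vertex set is deduced from the
correctness of the program. -/

/-! ### Linear forests -/

section LinearForest

variable {V : Type*}

/-- `H` without the edge `qw`. -/
abbrev cut (H : SimpleGraph V) (q w : V) : SimpleGraph V := H.deleteEdges {s(q, w)}

/-- `H` with the edge `vp` added. -/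
abbrev link (H : SimpleGraph V) (v p : V) : SimpleGraph V := H ⊔ SimpleGraph.edge v p

lemma cut_le (H : SimpleGraph V) (q w : V) : cut H q w ≤ H := SimpleGraph.deleteEdges_le _

lemma cut_adj {H : SimpleGraph V} {q w a b : V} :
    (cut H q w).Adj a b ↔ H.Adj a b ∧ ¬ (a = q ∧ b = w ∨ a = w ∧ b = q) := by
  simp [cut]

lemma link_adj {H : SimpleGraph V} {v p a b : V} (hvp : v ≠ p) :
    (link H v p).Adj a b ↔ H.Adj a b ∨ (a = v ∧ b = p ∨ a = p ∧ b = v) := by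
  simp only [link, SimpleGraph.sup_adj, SimpleGraph.edge_adj]
  grind

/-- Paths in a forest are unique, and a walk surviving the deletion would yield a second path, one
that avoids `qw`. -/
lemma not_reachable_cut_of_mem_edges {H : SimpleGraph V} (hH : H.IsAcyclic) {u a q w : V}
    {p : H.Walk u a} (hp : p.IsPath) (he : s(q, w) ∈ p.edges) : ¬ (cut H q w).Reachable u a := by
  classical
  rintro ⟨p'⟩
  have h1 := (hH.subsingleton_path u a).elim ⟨p, hp⟩
    ⟨p'.toPath.1.mapLe (cut_le H q w), p'.toPath.2.mapLe (cut_le H q w)⟩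
  have h2 : p = p'.toPath.1.mapLe (cut_le H q w) := congrArg Subtype.val h1
  rw [h2] at he
  have he' : s(q, w) ∈ p'.toPath.1.edges := by simpa using he
  have := p'.toPath.1.adj_of_mem_edges he'
  rw [cut_adj] at this
  simp at this

lemma exists_last_edge {H : SimpleGraph V} (hH : H.IsAcyclic) {u y : V} (h : H.Reachable u y)
    (hne : u ≠ y) : ∃ x, H.Adj y x ∧ ¬ (cut H y x).Reachable u y := by
  obtain ⟨p, hp⟩ := h.exists_isPath
  have hnil : ¬ p.Nil := SimpleGraph.Walk.not_nil_of_ne hne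
  refine ⟨p.penultimate, (p.adj_penultimate hnil).symm, not_reachable_cut_of_mem_edges hH hp ?_⟩
  rw [Sym2.eq_swap]
  exact p.mk_penultimate_end_mem_edges hnil

lemma exists_adj_of_reachable {H : SimpleGraph V} {u y : V} (h : H.Reachable u y)
    (hne : u ≠ y) : ∃ x, H.Adj y x := by
  obtain ⟨p⟩ := h
  exact ⟨p.penultimate, (p.adj_penultimate (SimpleGraph.Walk.not_nil_of_ne hne)).symm⟩

/-- Repeated passages of a walk through `qw` cancel, so at most one passage, in one of the two
directions, is needed. -/
lemma reachable_cut {H : SimpleGraph V} {q w x y : V} (h : H.Reachable x y) :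
    (cut H q w).Reachable x y ∨ ((cut H q w).Reachable x q ∧ (cut H q w).Reachable w y) ∨
      ((cut H q w).Reachable x w ∧ (cut H q w).Reachable q y) := by
  obtain ⟨p⟩ := h
  induction p with
  | nil => exact Or.inl (SimpleGraph.Reachable.refl _)
  | @cons x z y h p ih =>
    by_cases hc : (cut H q w).Adj x z
    · have := hc.reachable
      rcases ih with ih | ih | ih
      · exact Or.inl (this.trans ih)
      · exact Or.inr (Or.inl ⟨this.trans ih.1, ih.2⟩)
      · exact Or.inr (Or.inr ⟨this.trans ih.1, ih.2⟩)
    · rw [cut_adj] at hc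
      push Not at hc
      rcases hc h with ⟨rfl, rfl⟩ | ⟨rfl, rfl⟩
      · rcases ih with ih | ih | ih
        · exact Or.inr (Or.inl ⟨SimpleGraph.Reachable.refl _, ih⟩)
        · exact Or.inr (Or.inl ⟨SimpleGraph.Reachable.refl _, ih.2⟩)
        · exact Or.inl ih.2
      · rcases ih with ih | ih | ih
        · exact Or.inr (Or.inr ⟨SimpleGraph.Reachable.refl _, ih⟩)
        · exact Or.inl ih.2
        · exact Or.inr (Or.inr ⟨SimpleGraph.Reachable.refl _, ih.2⟩)

/-- Exchanging an edge of a path from `v` to `p` for the edge `vp` does not change components. -/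
lemma reachable_exchange {H : SimpleGraph V} {v p q w : V} (hqw : H.Adj q w)
    (hvp : H.Reachable v p) (hn : ¬ (cut H q w).Reachable v p) (b : V) :
    (link (cut H q w) v p).Reachable w b ↔ H.Reachable v b := by
  have hne : v ≠ p := by rintro rfl; exact hn (SimpleGraph.Reachable.refl _)
  set K := link (cut H q w) v p with hK
  have hcK : ∀ {a b}, (cut H q w).Reachable a b → K.Reachable a b :=
    fun h => h.mono le_sup_left
  have hvpK : K.Reachable v p := (SimpleGraph.Adj.reachable (by rw [hK, link_adj hne]; simp))
  -- The deletion separates `v` from `p`, so these lie on different sides of `qw`, and the new edge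
  -- `vp` reconnects the two sides.
  have hqwK : K.Reachable q w := by
    rcases reachable_cut (q := q) (w := w) hvp with h | h | h
    · exact absurd h hn
    · exact (hcK h.1).symm.trans (hvpK.trans (hcK h.2).symm)
    · exact ((hcK h.1).symm.trans (hvpK.trans (hcK h.2).symm)).symm
  have hHK : ∀ {a b}, H.Reachable a b → K.Reachable a b := by
    intro a b h
    rcases reachable_cut (q := q) (w := w) h with h | h | h
    · exact hcK h
    · exact (hcK h.1).trans (hqwK.trans (hcK h.2))
    · exact (hcK h.1).trans (hqwK.symm.trans (hcK h.2))
  have hKH : ∀ {a b}, K.Reachable a b → H.Reachable a b := by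
    rintro a b ⟨p'⟩
    induction p' with
    | nil => exact SimpleGraph.Reachable.refl _
    | cons h _ ih =>
      refine SimpleGraph.Reachable.trans ?_ ih
      rw [hK, link_adj hne] at h
      rcases h with h | ⟨rfl, rfl⟩ | ⟨rfl, rfl⟩
      · exact (cut_le _ _ _ h).reachable
      · exact hvp
      · exact hvp.symm
  have hvw : H.Reachable v w := by
    rcases reachable_cut (q := q) (w := w) hvp with h | h | h
    · exact absurd h hn
    · exact (h.1.mono (cut_le _ _ _)).trans hqw.reachable
    · exact h.1.mono (cut_le _ _ _)
  exact ⟨fun h => hvw.trans (hKH h), fun h => hHK (hvw.symm.trans h)⟩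

/-! ### Degrees, and path ends in linear forests -/

variable [Fintype V]

open Classical in
/-- The neighbours of `v` in `H`, as a finite set. -/
noncomputable def nbrs (H : SimpleGraph V) (v : V) : Finset V := Finset.univ.filter (H.Adj v)

/-- The degree of `v` in `H`. -/
noncomputable def dg (H : SimpleGraph V) (v : V) : ℕ := (nbrs H v).card

@[simp] lemma mem_nbrs {H : SimpleGraph V} {v w : V} : w ∈ nbrs H v ↔ H.Adj v w := by
  classical
  simp [nbrs]

lemma dg_mono {H K : SimpleGraph V} (h : H ≤ K) (v : V) : dg H v ≤ dg K v :=
  Finset.card_le_card fun w hw => by simp only [mem_nbrs] at *; exact h hw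

lemma eq_of_dg_le_one {H : SimpleGraph V} {v a b : V} (h : dg H v ≤ 1) (ha : H.Adj v a)
    (hb : H.Adj v b) : a = b :=
  Finset.card_le_one.1 h a (by simpa) b (by simpa)

lemma eq_or_eq_of_dg_le_two {H : SimpleGraph V} {v a b c : V} (h : dg H v ≤ 2) (ha : H.Adj v a)
    (hb : H.Adj v b) (hab : a ≠ b) (hc : H.Adj v c) : c = a ∨ c = b := by
  by_contra! hne
  have : 2 < (nbrs H v).card :=
    Finset.two_lt_card.2 ⟨a, by simpa, b, by simpa, c, by simpa, hab, hne.1.symm, hne.2.symm⟩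
  unfold dg at h
  omega

lemma two_le_dg {H : SimpleGraph V} {v a b : V} (ha : H.Adj v a) (hb : H.Adj v b)
    (hab : a ≠ b) : 2 ≤ dg H v :=
  Finset.one_lt_card.2 ⟨a, by simpa, b, by simpa, hab⟩

lemma one_le_dg {H : SimpleGraph V} {v a : V} (ha : H.Adj v a) : 1 ≤ dg H v :=
  Finset.card_pos.2 ⟨a, by simpa⟩

lemma exists_adj_of_one_le_dg {H : SimpleGraph V} {v : V} (h : 1 ≤ dg H v) : ∃ a, H.Adj v a := by
  obtain ⟨a, ha⟩ := Finset.card_pos.1 h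
  exact ⟨a, by simpa using ha⟩

lemma exists_adj_of_dg_lt {H K : SimpleGraph V} {v : V} (h : dg H v < dg K v) :
    ∃ u, K.Adj u v ∧ ¬ H.Adj u v := by
  by_contra! hall
  have : dg K v ≤ dg H v := Finset.card_le_card fun u hu => by
    simp only [mem_nbrs] at *
    exact (hall u hu.symm).symm
  omega

-- The equation is additive so that no truncated subtraction enters the degree counts.
open Classical in
lemma dg_cut {H : SimpleGraph V} {q w : V} (h : H.Adj q w) (u : V) :
    dg (cut H q w) u + (if u = q ∨ u = w then 1 else 0) = dg H u := by
  have hne := h.ne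
  split_ifs with hu
  · obtain ⟨t, ht, htu⟩ : ∃ t, H.Adj u t ∧ nbrs (cut H q w) u = (nbrs H u).erase t := by
      rcases hu with rfl | rfl
      · refine ⟨w, h, ?_⟩
        ext b; simp only [mem_nbrs, cut_adj, Finset.mem_erase]; grind
      · refine ⟨q, h.symm, ?_⟩
        ext b; simp only [mem_nbrs, cut_adj, Finset.mem_erase]; grind
    unfold dg
    rw [htu, Finset.card_erase_add_one (by simpa)]
  · unfold dg
    rw [add_zero]
    congr 1
    ext b; simp only [mem_nbrs, cut_adj]; grind

open Classical in
lemma dg_link {H : SimpleGraph V} {v p : V} (hne : v ≠ p) (h : ¬ H.Adj v p) (u : V) :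
    dg (link H v p) u = dg H u + (if u = v ∨ u = p then 1 else 0) := by
  have h' : ¬ H.Adj p v := fun h' => h h'.symm
  split_ifs with hu
  · obtain ⟨t, ht, htu⟩ : ∃ t, ¬ H.Adj u t ∧ nbrs (link H v p) u = insert t (nbrs H u) := by
      rcases hu with rfl | rfl
      · refine ⟨p, h, ?_⟩
        ext b; simp only [mem_nbrs, link_adj hne, Finset.mem_insert]; grind
      · refine ⟨v, h', ?_⟩
        ext b; simp only [mem_nbrs, link_adj hne, Finset.mem_insert]; grind
    unfold dg
    rw [htu, Finset.card_insert_of_notMem (by simpa)]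
  · unfold dg
    rw [add_zero]
    congr 1
    ext b; simp only [mem_nbrs, link_adj hne]; grind

/-- Acyclic graphs with all degrees at most two. -/
structure IsLinForest (H : SimpleGraph V) : Prop where
  acyclic : H.IsAcyclic
  dg_le : ∀ v, dg H v ≤ 2

lemma IsLinForest.mono {H K : SimpleGraph V} (h : H ≤ K) (hK : IsLinForest K) : IsLinForest H :=
  ⟨hK.acyclic.anti h, fun v => (dg_mono h v).trans (hK.dg_le v)⟩

lemma IsLinForest.link {H : SimpleGraph V} (hH : IsLinForest H) {v p : V}
    (h : ¬ H.Reachable v p) (hv : dg H v ≤ 1) (hp : dg H p ≤ 1) : IsLinForest (link H v p) := by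
  classical
  have hne : v ≠ p := by rintro rfl; exact h (SimpleGraph.Reachable.refl _)
  refine ⟨SimpleGraph.IsAcyclic.sup_edge_of_not_reachable h hH.acyclic, fun u => ?_⟩
  rw [dg_link hne fun hadj => h hadj.reachable]
  have := hH.dg_le u
  split_ifs with hu
  · rcases hu with rfl | rfl <;> omega
  · omega

lemma two_le_dg_of_mem_support {H : SimpleGraph V} {u a b : V} (p : H.Walk u a) (hp : p.IsPath)
    (hb : b ∈ p.support) (hbu : b ≠ u) (hba : b ≠ a) : 2 ≤ dg H b := by
  induction p with
  | nil => simp at hb; exact absurd hb hbu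
  | @cons u v a h q ih =>
    rw [SimpleGraph.Walk.cons_isPath_iff] at hp
    have hbq : b ∈ q.support := by simpa [hbu] using hb
    by_cases hbv : b = v
    · subst hbv
      cases q with
      | nil => exact absurd rfl hba
      | @cons _ v' _ h' q' =>
        refine two_le_dg h.symm h' ?_
        rintro rfl
        exact hp.2 (by simp)
    · exact ih hp.1 hbq hbv hba

/-- An inner vertex already has its two path edges and the degree bound leaves no third; the far end
has only its last edge. The start is excluded so that the induction can pass to the tail, whose
start also has the edge leading back. -/
lemma mem_edges_of_mem_support_aux {H : SimpleGraph V} (h2 : ∀ v, dg H v ≤ 2) {u a : V}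
    (p : H.Walk u a) (hp : p.IsPath) (ha : dg H a ≤ 1) {x y : V} (hx : x ∈ p.support) (hxu : x ≠ u)
    (hxy : H.Adj x y) : s(x, y) ∈ p.edges := by
  induction p with
  | nil => simp at hx; exact absurd hx hxu
  | @cons u v a h q ih =>
    rw [SimpleGraph.Walk.cons_isPath_iff] at hp
    have hxq : x ∈ q.support := by simpa [hxu] using hx
    by_cases hxv : x = v
    · subst hxv
      cases q with
      | nil =>
        rw [eq_of_dg_le_one ha hxy h.symm, Sym2.eq_swap]; simp
      | @cons _ v' _ h' q' =>
        have hne : u ≠ v' := by rintro rfl; exact hp.2 (by simp)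
        rcases eq_or_eq_of_dg_le_two (h2 _) h.symm h' hne hxy with rfl | rfl
        · rw [Sym2.eq_swap]; simp
        · simp
    · simp only [SimpleGraph.Walk.edges_cons, List.mem_cons]
      exact Or.inr (ih hp.1 ha hxq hxv)

lemma mem_edges_of_mem_support {H : SimpleGraph V} (h2 : ∀ v, dg H v ≤ 2) {u a : V} (hne : u ≠ a)
    {p : H.Walk u a} (hp : p.IsPath) (hu : dg H u ≤ 1) (ha : dg H a ≤ 1) {x y : V}
    (hx : x ∈ p.support) (hxy : H.Adj x y) : s(x, y) ∈ p.edges := by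
  by_cases hxu : x = u
  · subst hxu
    cases p with
    | nil => exact absurd rfl hne
    | cons h q => rw [eq_of_dg_le_one hu hxy h]; simp
  · exact mem_edges_of_mem_support_aux h2 p hp ha hx hxu hxy

/-- No edge leaves a path between two vertices of degree at most one, so the path is the whole
component. -/
lemma mem_support_of_reachable {H : SimpleGraph V} (h2 : ∀ v, dg H v ≤ 2) {u a : V} (hne : u ≠ a)
    {p : H.Walk u a} (hp : p.IsPath) (hu : dg H u ≤ 1) (ha : dg H a ≤ 1) {x : V}
    (hx : H.Reachable u x) : x ∈ p.support := by
  obtain ⟨q⟩ := hx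
  have key : ∀ {c d : V} (q : H.Walk c d), c ∈ p.support → d ∈ p.support := by
    intro c d q
    induction q with
    | nil => exact id
    | cons h q ih =>
      intro hc
      exact ih (SimpleGraph.Walk.snd_mem_support_of_mem_edges p
        (mem_edges_of_mem_support h2 hne hp hu ha hc h))
  exact key q p.start_mem_support

/-- The component of a linear forest has at most two vertices of degree at most one. -/
lemma eq_or_eq_of_reachable {H : SimpleGraph V} (h2 : ∀ v, dg H v ≤ 2) {u a b : V} (hne : u ≠ a)
    (hua : H.Reachable u a) (hub : H.Reachable u b) (hu : dg H u ≤ 1) (ha : dg H a ≤ 1)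
    (hb : dg H b ≤ 1) : b = u ∨ b = a := by
  obtain ⟨p, hp⟩ := hua.exists_isPath
  by_contra! h
  have := two_le_dg_of_mem_support p hp (mem_support_of_reachable h2 hne hp hu ha hub) h.1 h.2
  omega

/-- The path joining the two ends fills the component, so it uses every edge there. This makes every
edge of the component available for an exchange with `ua`. -/
lemma not_reachable_cut_of_ends {H : SimpleGraph V} (hH : IsLinForest H) {u a q w : V}
    (hne : u ≠ a) (hua : H.Reachable u a) (hu : dg H u ≤ 1) (ha : dg H a ≤ 1)
    (hqw : H.Adj q w) (hw : H.Reachable u w) : ¬ (cut H q w).Reachable u a := by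
  obtain ⟨p, hp⟩ := hua.exists_isPath
  refine not_reachable_cut_of_mem_edges hH.acyclic hp ?_
  rw [Sym2.eq_swap]
  exact mem_edges_of_mem_support hH.dg_le hne hp hu ha
    (mem_support_of_reachable hH.dg_le hne hp hu ha hw) hqw.symm

end LinearForest

/-! ### The augmentation search -/

namespace AugSearch

variable {V : Type*} [Fintype V]

/-- The data of a search: a linear forest `F` in a bipartite graph `G` with parts `A` and `Aᶜ`, and
a vertex `v₀` of `A` at which an edge is to be gained. -/
structure Start (G : SimpleGraph V) (A : Set V) (F : SimpleGraph V) (v₀ : V) : Prop where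
  bip : ∀ ⦃u v⦄, G.Adj u v → (u ∈ A ↔ v ∉ A)
  le : F ≤ G
  forest : IsLinForest F
  mem : v₀ ∈ A
  deg : dg F v₀ ≤ 1

/-- Adding `vp` to `S v` gains an edge without losing one. -/
structure Gain (G : SimpleGraph V) (D : Finset V) (S : V → SimpleGraph V) (v p : V) : Prop where
  mem : v ∈ D
  adj : G.Adj v p
  notAdj : ¬ (S v).Adj v p
  sep : ¬ (S v).Reachable v p
  deg : dg (S v) p ≤ 1

/-- Exchanging `qw` for `vp` in `S v` moves the missing edge from `v` to the new vertex `w`. -/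
structure Move (G : SimpleGraph V) (A : Set V) (D : Finset V) (S : V → SimpleGraph V)
    (v p q w : V) : Prop where
  mem : v ∈ D
  adj : G.Adj v p
  notAdj : ¬ (S v).Adj v p
  edge : (S v).Adj q w
  side : w ∈ A
  new : w ∉ D
  sep : ¬ (cut (S v) q w).Reachable v p
  deg : dg (cut (S v) q w) p ≤ 1

/-- The vertices `a` with one edge in `F` that were hit from the other end of their path. -/
def Closed (G F : SimpleGraph V) (D : Finset V) (S : V → SimpleGraph V) : Set V :=
  {a | dg F a = 1 ∧ ∃ u ∈ D, G.Adj u a ∧ ¬ F.Adj u a ∧ (S u).Reachable u a ∧ dg (S u) a ≤ 1}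

/-- The vertices outside `A` with two edges in `F`, both leading to `D`. -/
def Full (A : Set V) (F : SimpleGraph V) (D : Finset V) : Set V :=
  {y | y ∉ A ∧ dg F y = 2 ∧ ∀ x, F.Adj x y → x ∈ D}

open Classical in
/-- The states of a search: for each reached vertex `v ∈ D`, the graph `S v` is a linear forest
that has the degrees wanted, up to one edge missing at `v`. -/
structure State (G : SimpleGraph V) (A : Set V) (F : SimpleGraph V) (v₀ : V) (D : Finset V)
    (S : V → SimpleGraph V) : Prop where
  start : v₀ ∈ D
  sub : ∀ v ∈ D, v ∈ A
  le : ∀ v ∈ D, S v ≤ G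
  forest : ∀ v ∈ D, IsLinForest (S v)
  deg_mem : ∀ v ∈ D, ∀ u ∈ A,
    dg (S v) u + (if u = v then 1 else 0) = dg F u + (if u = v₀ then 1 else 0)
  deg_notMem : ∀ v ∈ D, ∀ u ∉ A, 1 ≤ dg F u → 1 ≤ dg (S v) u
  self : ∀ v ∈ D, ∀ p, (S v).Adj v p → F.Adj v p
  out : ∀ v ∈ D, ∀ w ∈ A, w ∉ D → ∀ p, (S v).Adj w p ↔ F.Adj w p
  closed : ∀ v ∈ D, ∀ a, dg F a = 1 → ∀ u ∈ A, (S v).Adj u a → ¬ F.Adj u a → a ∈ Closed G F D S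
  isolated : ∀ v ∈ D, ∀ a ∉ A, dg F a = 0 → dg (S v) a = 0

/-- The division of the reached vertices into older ones `E` and those reached from `r` without
leaving its component. -/
structure Stage (G : SimpleGraph V) (A : Set V) (F : SimpleGraph V) (D : Finset V)
    (S : V → SimpleGraph V) (E : Finset V) (r : V) : Prop where
  sub : E ⊆ D
  mem : r ∈ D
  notMem : r ∉ E
  card : (Closed G F E S).ncard ≤ (Full A F E).ncard
  adj_closed : ∀ a ∈ Closed G F E S, ∀ x, F.Adj x a → x ∈ E
  component : ∀ u ∈ D, u ∉ E → ∀ b, (S u).Reachable u b ↔ (S r).Reachable r b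
  root_closed : ∀ a, dg F a = 1 → ∀ u ∈ A, (S r).Adj u a → ¬ F.Adj u a → a ∈ Closed G F E S

variable {G : SimpleGraph V} {A : Set V} {F : SimpleGraph V} {v₀ : V} {D E : Finset V}
  {S : V → SimpleGraph V} {r : V}

/-- The missing edge brings the degree down from at most two. For `v = v₀` it cancels against the
wanted edge, and the bound is `hF.deg`. -/
lemma State.dg_self_le (hF : Start G A F v₀) (h : State G A F v₀ D S) {v : V} (hv : v ∈ D) :
    dg (S v) v ≤ 1 := by
  have h1 := h.deg_mem v hv v (h.sub v hv)
  have h2 := hF.forest.dg_le v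
  have h3 := hF.deg
  rw [if_pos rfl] at h1
  split_ifs at h1 with h4
  · subst h4; omega
  · omega

lemma State.init (hF : Start G A F v₀) (hS : S v₀ = F) : State G A F v₀ {v₀} S where
  start := by simp
  sub := by simp [hF.mem]
  le := by simp [hS, hF.le]
  forest := by simp [hS, hF.forest]
  deg_mem := by simp [hS]
  deg_notMem := by simp [hS]
  self := by simp [hS]
  out := by simp [hS]
  closed := by simp [hS]; tauto
  isolated := by simp [hS]

lemma Stage.init (hS : S v₀ = F) : Stage G A F {v₀} S ∅ v₀ where
  sub := by simp
  mem := by simp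
  notMem := by simp
  card := by simp [Closed]
  adj_closed := by simp [Closed]
  component := by simp
  root_closed := by simp [hS]; tauto

lemma State.notAdj_self (h : State G A F v₀ D S) {u a : V} (hu : u ∈ D) (hn : ¬ F.Adj u a) :
    ¬ (S u).Adj u a := fun hadj => hn (h.self u hu a hadj)

lemma Closed.mono {S' : V → SimpleGraph V} (hDE : E ⊆ D) (hS : ∀ v ∈ E, S' v = S v) :
    Closed G F E S ⊆ Closed G F D S' := by
  rintro a ⟨h1, u, hu, h2, h3, h4, h5⟩
  exact ⟨h1, u, hDE hu, h2, h3, by rwa [hS u hu], by rwa [hS u hu]⟩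

lemma Closed.congr {S' : V → SimpleGraph V} (hS : ∀ v ∈ E, S' v = S v) :
    Closed G F E S' = Closed G F E S :=
  (Closed.mono subset_rfl fun v hv => (hS v hv).symm).antisymm (Closed.mono subset_rfl hS)

/-- Whether or not it is the end of its path, a vertex with one edge in `F` that takes part in a
move was hit from the other end of its path. -/
lemma State.closed_of_hit (h : State G A F v₀ D S) (hno : ∀ v p, ¬ Gain G D S v p) {v p : V}
    (hF : Start G A F v₀) (hv : v ∈ D) (hadj : G.Adj v p) (hn : ¬ F.Adj v p) (hp : dg F p = 1) :
    p ∈ Closed G F D S := by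
  -- If `p` has at most one edge in `S v`, the absence of gains forces it into the component of `v`.
  -- Otherwise `S v` has an edge at `p` outside `F`, and the invariant `closed` applies.
  by_cases hd : dg (S v) p ≤ 1
  · refine ⟨hp, v, hv, hadj, hn, ?_, hd⟩
    by_contra hr
    exact hno v p ⟨hv, hadj, h.notAdj_self hv hn, hr, hd⟩
  · obtain ⟨u, hu, huF⟩ := exists_adj_of_dg_lt (H := F) (K := S v) (v := p) (by omega)
    have hvA := h.sub v hv
    have hpA : p ∉ A := (hF.bip hadj).1 hvA
    exact h.closed v hv p hp u ((hF.bip (h.le v hv hu)).2 hpA) hu huF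

/-! ### The effect of one move on the invariants -/

section step

variable {v p q w : V}

lemma Move.ne (hm : Move G A D S v p q w) : v ≠ p := hm.adj.ne

lemma Move.notAdj_cut (hm : Move G A D S v p q w) : ¬ (cut (S v) q w).Adj v p :=
  fun h => hm.notAdj (cut_le _ _ _ h)

/-- A degree outside `A` does not drop to zero in a move. -/
lemma State.one_le_dg_of_move (hF : Start G A F v₀) (h : State G A F v₀ D S)
    (hno : ∀ v p, ¬ Gain G D S v p) (hm : Move G A D S v p q w) {u : V} (huA : u ∉ A)
    (hu : 1 ≤ dg F u) : 1 ≤ dg (link (cut (S v) q w) v p) u := by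
  classical
  have hvA := h.sub v hm.mem
  have hpA : p ∉ A := (hF.bip hm.adj).1 hvA
  have hqA : q ∉ A := fun hq => (hF.bip (h.le v hm.mem hm.edge)).1 hq hm.side
  have h1 := h.deg_notMem v hm.mem u huA hu
  have h2 := dg_cut hm.edge u
  rw [dg_link hm.ne hm.notAdj_cut]
  by_cases hup : u = p
  · simp [hup]
  have huw : u ≠ w := fun huw => huA (huw ▸ hm.side)
  -- Outside `A` only `q` loses an edge.
  by_cases huq : u = q
  swap
  · simp [huq, huw] at h2; omega
  subst huq
  by_contra! hlt
  simp at h2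
  have hu1 : dg (S v) u ≤ 1 := by omega
  have hp1 : dg (S v) p ≤ 1 := by
    have h3 := dg_cut hm.edge p
    have hpw : p ≠ w := fun hpw => hpA (hpw ▸ hm.side)
    have := hm.deg
    simp [Ne.symm hup, hpw] at h3
    omega
  have hvp : (S v).Reachable v p := by
    by_contra hr
    exact hno v p ⟨hm.mem, hm.adj, hm.notAdj, hr, hp1⟩
  have hvu : (S v).Reachable v u := by
    rcases reachable_cut (q := u) (w := w) hvp with hr | hr | hr
    · exact absurd hr hm.sep
    · exact hr.1.mono (cut_le _ _ _)
    · exact (hr.1.mono (cut_le _ _ _)).trans hm.edge.symm.reachable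
  -- Now `v`, `p` and `q` would be three vertices of degree at most one in one path component.
  rcases eq_or_eq_of_reachable (h.forest v hm.mem).dg_le hm.ne hvp hvu
    (h.dg_self_le hF hm.mem) hp1 hu1 with rfl | rfl
  · exact huA hvA
  · exact hup rfl

/-- The closed vertices and the new edge of a move. -/
lemma State.closed_of_move (hF : Start G A F v₀) (h : State G A F v₀ D S)
    (hno : ∀ v p, ¬ Gain G D S v p) (hm : Move G A D S v p q w) {a u : V} (ha : dg F a = 1)
    (hu : u ∈ A) (hadj : (link (cut (S v) q w) v p).Adj u a) (hn : ¬ F.Adj u a) :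
    a ∈ Closed G F D S := by
  rw [link_adj hm.ne] at hadj
  rcases hadj with hadj | ⟨rfl, rfl⟩ | ⟨rfl, rfl⟩
  · exact h.closed v hm.mem a ha u hu (cut_le _ _ _ hadj) hn
  · exact h.closed_of_hit hno hF hm.mem hm.adj hn ha
  · exact absurd hu ((hF.bip hm.adj).1 (h.sub _ hm.mem))

-- On `A` the exchange only shifts the missing edge: `v` gains `vp`, `w` loses `qw`, and `p`, `q`
-- lie outside `A`. The absence of gains serves the clauses about vertices outside `A`.
open Classical in
lemma State.step (hF : Start G A F v₀) (h : State G A F v₀ D S)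
    (hno : ∀ v p, ¬ Gain G D S v p) (hm : Move G A D S v p q w) :
    State G A F v₀ (insert w D) (Function.update S w (link (cut (S v) q w) v p)) := by
  have hold : ∀ u ∈ D, Function.update S w (link (cut (S v) q w) v p) u = S u := fun u hu =>
    Function.update_of_ne (fun he => hm.new (by rwa [he] at hu)) _ _
  have hnew : Function.update S w (link (cut (S v) q w) v p) w = link (cut (S v) q w) v p :=
    Function.update_self ..
  have hvA := h.sub v hm.mem
  have hpA : p ∉ A := (hF.bip hm.adj).1 hvA
  have hqA : q ∉ A := fun hq => (hF.bip (h.le v hm.mem hm.edge)).1 hq hm.side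
  have hvw : v ≠ w := fun he => hm.new (by rw [← he]; exact hm.mem)
  have hwp : w ≠ p := fun he => hpA (by rw [← he]; exact hm.side)
  have hcl : Closed G F D S ⊆
      Closed G F (insert w D) (Function.update S w (link (cut (S v) q w) v p)) :=
    Closed.mono (Finset.subset_insert _ _) hold
  have hcutF := (h.forest v hm.mem).mono (cut_le (S v) q w)
  refine ⟨Finset.mem_insert_of_mem h.start, ?_, ?_, ?_, ?_, ?_, ?_, ?_, ?_, ?_⟩ <;>
    refine Finset.forall_mem_insert _ _ _ |>.2 ⟨?_, ?_⟩
  · exact hm.side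
  · exact h.sub
  · rw [hnew]
    intro a b hab
    rw [link_adj hm.ne] at hab
    rcases hab with hab | ⟨rfl, rfl⟩ | ⟨rfl, rfl⟩
    · exact h.le v hm.mem (cut_le _ _ _ hab)
    · exact hm.adj
    · exact hm.adj.symm
  · intro u hu; rw [hold u hu]; exact h.le u hu
  · rw [hnew]
    exact hcutF.link hm.sep ((dg_mono (cut_le _ _ _) _).trans (h.dg_self_le hF hm.mem)) hm.deg
  · intro u hu; rw [hold u hu]; exact h.forest u hu
  · intro u hu
    rw [hnew, dg_link hm.ne hm.notAdj_cut]
    have h1 := h.deg_mem v hm.mem u hu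
    have h2 := dg_cut hm.edge u
    have hup : u ≠ p := fun he => hpA (he ▸ hu)
    have huq : u ≠ q := fun he => hqA (he ▸ hu)
    simp only [hup, huq, or_false, false_or] at h2 ⊢
    omega
  · intro u hu; rw [hold u hu]; exact h.deg_mem u hu
  · intro u huA hu
    rw [hnew]
    exact h.one_le_dg_of_move hF hno hm huA hu
  · intro u hu; rw [hold u hu]; exact h.deg_notMem u hu
  -- As `w` was not reached before, its edges in `S v` are edges of `F` by `out`, and the added edge
  -- does not meet `w`.
  · intro b hb
    rw [hnew, link_adj hm.ne] at hb
    rcases hb with hb | ⟨h1, -⟩ | ⟨h1, -⟩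
    · exact (h.out v hm.mem w hm.side hm.new b).1 (cut_le _ _ _ hb)
    · exact absurd h1.symm hvw
    · exact absurd h1 hwp
  · intro u hu; rw [hold u hu]; exact h.self u hu
  · intro x hx hxn b
    rw [Finset.mem_insert, not_or] at hxn
    rw [hnew, link_adj hm.ne, cut_adj, ← h.out v hm.mem x hx hxn.2 b]
    have hxv : x ≠ v := fun he => hxn.2 (he ▸ hm.mem)
    have hxp : x ≠ p := fun he => hpA (he ▸ hx)
    have hxq : x ≠ q := fun he => hqA (he ▸ hx)
    simp [hxv, hxp, hxq, hxn.1]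
  · intro u hu x hx hxn
    rw [hold u hu]
    exact h.out u hu x hx fun hxD => hxn (Finset.mem_insert_of_mem hxD)
  · intro a ha u hu hadj hn
    rw [hnew] at hadj
    exact hcl (h.closed_of_move hF hno hm ha hu hadj hn)
  · intro u hu
    rw [hold u hu]
    exact fun a ha x hx h1 h2 => hcl (h.closed u hu a ha x hx h1 h2)
  · intro a haA ha
    have h1 := h.isolated v hm.mem a haA ha
    rw [hnew, dg_link hm.ne hm.notAdj_cut]
    have h2 := dg_mono (cut_le (S v) q w) a
    have hav : a ≠ v := fun he => haA (he ▸ hvA)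
    -- A vertex `p` isolated in `F` is isolated in `S v`, and then `vp` would be a gain.
    have hap : a ≠ p := by
      rintro rfl
      refine hno v a ⟨hm.mem, hm.adj, hm.notAdj, fun hr => ?_, by omega⟩
      obtain ⟨x, hx⟩ := exists_adj_of_reachable hr hm.ne
      have := one_le_dg hx
      omega
    simp only [hav, hap, or_self, if_false]
    omega
  · intro u hu; rw [hold u hu]; exact h.isolated u hu

open Classical in
/-- A move inside a component continues the stage. -/
lemma Stage.step (hs : Stage G A F D S E r)
    (hm : Move G A D S v p q w) (hvE : v ∉ E) (hr : (S v).Reachable v p) :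
    Stage G A F (insert w D) (Function.update S w (link (cut (S v) q w) v p)) E r := by
  have hold : ∀ u ∈ D, Function.update S w (link (cut (S v) q w) v p) u = S u := fun u hu =>
    Function.update_of_ne (fun he => hm.new (by rwa [he] at hu)) _ _
  have hnew : Function.update S w (link (cut (S v) q w) v p) w = link (cut (S v) q w) v p :=
    Function.update_self ..
  have hE := Closed.congr (G := G) (F := F) fun u hu => hold u (hs.sub hu)
  refine ⟨hs.sub.trans (Finset.subset_insert _ _), Finset.mem_insert_of_mem hs.mem, hs.notMem,
    ?_, ?_, ?_, ?_⟩
  · rw [hE]; exact hs.card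
  · rw [hE]; exact hs.adj_closed
  · rw [hold r hs.mem]
    refine Finset.forall_mem_insert _ _ _ |>.2 ⟨fun _ b => ?_, fun u hu => ?_⟩
    · rw [hnew, reachable_exchange hm.edge hr hm.sep, hs.component v hm.mem hvE]
    · rw [hold u hu]; exact hs.component u hu
  · rw [hold r hs.mem, hE]; exact hs.root_closed

open Classical in
/-- A move opens a new stage once the old stages satisfy their count. -/
lemma Stage.next (hF : Start G A F v₀) (h : State G A F v₀ D S)
    (hno : ∀ v p, ¬ Gain G D S v p) (hm : Move G A D S v p q w)
    (hcard : (Closed G F D S).ncard ≤ (Full A F D).ncard)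
    (hadj : ∀ a ∈ Closed G F D S, ∀ x, F.Adj x a → x ∈ D) :
    Stage G A F (insert w D) (Function.update S w (link (cut (S v) q w) v p)) D w := by
  have hold : ∀ u ∈ D, Function.update S w (link (cut (S v) q w) v p) u = S u := fun u hu =>
    Function.update_of_ne (fun he => hm.new (by rwa [he] at hu)) _ _
  have hnew : Function.update S w (link (cut (S v) q w) v p) w = link (cut (S v) q w) v p :=
    Function.update_self ..
  have hE := Closed.congr (G := G) (F := F) hold
  refine ⟨Finset.subset_insert _ _, Finset.mem_insert_self _ _, hm.new, ?_, ?_, ?_, ?_⟩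
  · rwa [hE]
  · rwa [hE]
  · intro u hu huD
    rcases Finset.mem_insert.1 hu with rfl | hu
    · simp
    · exact absurd hu huD
  · intro a ha u hu hadj hn
    rw [hnew] at hadj
    rw [hE]
    exact h.closed_of_move hF hno hm ha hu hadj hn

end step

/-- When no move inside a component is left, a component whose two ends can be joined has been
reached completely. -/
lemma State.mem_of_closed (hF : Start G A F v₀) (h : State G A F v₀ D S)
    (hint : ∀ v p q w, Move G A D S v p q w → ¬ (S v).Reachable v p) {u a x : V} (hu : u ∈ D)
    (hadj : G.Adj u a) (hn : ¬ F.Adj u a) (hr : (S u).Reachable u a) (ha : dg (S u) a ≤ 1)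
    (hxA : x ∈ A) (hx : (S u).Reachable u x) : x ∈ D := by
  by_contra hxD
  have hux : u ≠ x := fun he => hxD (he ▸ hu)
  obtain ⟨q, hq⟩ := exists_adj_of_reachable hx hux
  -- The path from `u` to `a` fills the component, so deleting any edge at `x` separates `u` from
  -- `a`, and an unreached `x` would be the target of a move inside the component.
  exact hint u a q x ⟨hu, hadj, h.notAdj_self hu hn, hq.symm, hxA, hxD,
    not_reachable_cut_of_ends (h.forest u hu) hadj.ne hr (h.dg_self_le hF hu) ha hq.symm hx,
    (dg_mono (cut_le _ _ _) _).trans ha⟩ hr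

/-- When no move inside a component is left, the count of the finished stage holds. -/
lemma Stage.saturated (hF : Start G A F v₀) (h : State G A F v₀ D S) (hs : Stage G A F D S E r)
    (hint : ∀ v p q w, Move G A D S v p q w → ¬ (S v).Reachable v p) :
    (Closed G F D S).ncard ≤ (Full A F D).ncard ∧
      ∀ a ∈ Closed G F D S, ∀ x, F.Adj x a → x ∈ D := by
  classical
  have hbipF : ∀ {x y}, F.Adj x y → (x ∈ A ↔ y ∉ A) := fun hxy => hF.bip (hF.le hxy)
  have hAadj : ∀ a ∈ Closed G F D S, ∀ x, F.Adj x a → x ∈ D := by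
    rintro a ⟨-, u, hu, h2, h3, h4, h5⟩ x hxa
    by_contra hxD
    have haA : a ∉ A := (hF.bip h2).1 (h.sub u hu)
    have hxA : x ∈ A := (hbipF hxa).2 haA
    have hS : (S u).Adj x a := (h.out u hu x hxA hxD a).2 hxa
    exact hxD (h.mem_of_closed hF hint hu h2 h3 h4 h5 hxA (h4.trans hS.symm.reachable))
  refine ⟨?_, hAadj⟩
  have hfull : Full A F E ⊆ Full A F D :=
    fun y hy => ⟨hy.1, hy.2.1, fun x hx => hs.sub (hy.2.2 x hx)⟩
  by_cases hsub : Closed G F D S ⊆ Closed G F E S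
  · exact (Set.ncard_le_ncard hsub).trans (hs.card.trans (Set.ncard_le_ncard hfull))
  obtain ⟨a, haD, haE⟩ := Set.not_subset.1 hsub
  have hrA := h.sub r hs.mem
  -- A newly closed vertex is an end of the path of `r`: a second edge at it in `S r` would lie
  -- outside `F`, and `root_closed` would have closed it earlier.
  have key : ∀ b ∈ Closed G F D S, b ∉ Closed G F E S →
      b ∉ A ∧ (S r).Reachable r b ∧ dg (S r) b ≤ 1 := by
    rintro b ⟨h1, u, hu, h2, h3, h4, h5⟩ hbE
    have huE : u ∉ E := fun huE => hbE ⟨h1, u, huE, h2, h3, h4, h5⟩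
    have hbA : b ∉ A := (hF.bip h2).1 (h.sub u hu)
    refine ⟨hbA, (hs.component u hu huE b).1 h4, ?_⟩
    by_contra hd
    obtain ⟨x, hx, hxF⟩ := exists_adj_of_dg_lt (H := F) (K := S r) (v := b) (by omega)
    exact hbE (hs.root_closed b h1 x ((hF.bip (h.le r hs.mem hx)).2 hbA) hx hxF)
  obtain ⟨haA, hra, hda⟩ := key a haD haE
  have hrne : r ≠ a := fun he => haA (he ▸ hrA)
  have hr1 := h.dg_self_le hF hs.mem
  have h2r := (h.forest r hs.mem).dg_le
  -- The path of `r` has only one end other than `r`, so a stage closes at most one new vertex.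
  have hins : Closed G F D S ⊆ insert a (Closed G F E S) := by
    intro b hb
    by_cases hbE : b ∈ Closed G F E S
    · exact Or.inr hbE
    · obtain ⟨hbA, hrb, hdb⟩ := key b hb hbE
      rcases eq_or_eq_of_reachable h2r hrne hra hrb hr1 hda hdb with rfl | rfl
      · exact absurd hrA hbA
      · exact Or.inl rfl
  -- The new closed vertex `a` is charged to the neighbour `y` of the root on its path.
  obtain ⟨y, hy⟩ := exists_adj_of_reachable hra.symm hrne.symm
  have hyF : F.Adj r y := h.self r hs.mem y hy
  have hyA : y ∉ A := (hbipF hyF).1 hrA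
  obtain ⟨hFa, u, hu, h2, h3, h4, h5⟩ := haD
  have huE : u ∉ E := fun huE => haE ⟨hFa, u, huE, h2, h3, h4, h5⟩
  have hcomp := hs.component u hu huE
  have hyall : ∀ x, F.Adj x y → x ∈ D := by
    intro x hxy
    by_contra hxD
    have hxA : x ∈ A := (hbipF hxy).2 hyA
    have hS : (S r).Adj x y := (h.out r hs.mem x hxA hxD y).2 hxy
    exact hxD (h.mem_of_closed hF hint hu h2 h3 h4 h5 hxA
      ((hcomp x).2 (hy.reachable.trans hS.symm.reachable)))
  -- If `y` had only one edge in `F`, it would be the end `a` itself, and the component would be the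
  -- single edge `ra`. That leaves no place for `u`, which lies in this component and hits `a` along
  -- an edge outside `F`.
  have hy2 : dg F y = 2 := by
    have hle := hF.forest.dg_le y
    have hge := one_le_dg hyF.symm
    by_contra hne
    have hy1 : dg F y = 1 := by omega
    by_cases hyc : y ∈ Closed G F E S
    · exact hs.notMem (hs.adj_closed y hyc r hyF)
    have hdy : dg (S r) y ≤ 1 := by
      by_contra hd
      obtain ⟨x, hx, hxF⟩ := exists_adj_of_dg_lt (H := F) (K := S r) (v := y) (by omega)
      exact hyc (hs.root_closed y hy1 x ((hF.bip (h.le r hs.mem hx)).2 hyA) hx hxF)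
    rcases eq_or_eq_of_reachable h2r hrne hra hy.reachable hr1 hda hdy with rfl | rfl
    · exact hyA hrA
    have hur : (S r).Reachable r u := (hcomp u).1 (SimpleGraph.Reachable.refl _)
    have hune : u ≠ r := by rintro rfl; exact h3 hyF
    have huy : u ≠ y := by rintro rfl; exact h2.ne rfl
    obtain ⟨p, hp⟩ := hra.exists_isPath
    have hpeq := ((h.forest r hs.mem).acyclic.subsingleton_path r y).elim ⟨p, hp⟩
      ⟨SimpleGraph.Walk.cons hy SimpleGraph.Walk.nil, by simp [hrne]⟩
    have hpe : p = SimpleGraph.Walk.cons hy SimpleGraph.Walk.nil := congrArg Subtype.val hpeq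
    have := mem_support_of_reachable h2r hrne hp hr1 hda hur
    rw [hpe] at this
    simp [hune, huy] at this
  have hyfull : insert y (Full A F E) ⊆ Full A F D :=
    Set.insert_subset ⟨hyA, hy2, hyall⟩ hfull
  -- The root is a neighbour of `y` in `F` that does not belong to `E`, so `y` has not been charged
  -- before.
  have hynot : y ∉ Full A F E := fun hyE => hs.notMem (hyE.2.2 r hyF)
  calc (Closed G F D S).ncard ≤ (insert a (Closed G F E S)).ncard := Set.ncard_le_ncard hins
    _ ≤ (Closed G F E S).ncard + 1 := Set.ncard_insert_le _ _
    _ ≤ (Full A F E).ncard + 1 := Nat.add_le_add_right hs.card 1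
    _ = (insert y (Full A F E)).ncard := (Set.ncard_insert_of_notMem hynot).symm
    _ ≤ (Full A F D).ncard := Set.ncard_le_ncard hyfull

end AugSearch

namespace AugSearch

variable {V : Type*} [Fintype V] {G : SimpleGraph V} {A : Set V} {F : SimpleGraph V} {v₀ : V}
  {D : Finset V} {S : V → SimpleGraph V}

/-! ### A search cannot get stuck -/

open Classical in
lemma sum_dg_eq (F : SimpleGraph V) (D : Finset V) :
    ∑ x ∈ D, dg F x = ∑ y, (D.filter (F.Adj · y)).card := by
  have := Finset.sum_card_bipartiteAbove_eq_sum_card_bipartiteBelow (s := D)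
    (t := (Finset.univ : Finset V)) F.Adj
  exact this

open Classical in
lemma sum_dg_sub_eq (hle : F ≤ G) (D : Finset V) :
    ∑ x ∈ D, dg G x = ∑ x ∈ D, dg F x + ∑ y, (D.filter fun x => G.Adj x y ∧ ¬ F.Adj x y).card := by
  rw [sum_dg_eq, sum_dg_eq, ← Finset.sum_add_distrib]
  refine Finset.sum_congr rfl fun y _ => ?_
  rw [← Finset.card_union_of_disjoint]
  · congr 1
    ext x
    simp only [Finset.mem_filter, Finset.mem_union]
    have := @hle x y
    tauto
  · rw [Finset.disjoint_left]
    intro x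
    simp only [Finset.mem_filter]
    tauto

open Classical in
lemma card_new_add_dg_le (hle : F ≤ G) (D : Finset V) (y : V) :
    (D.filter fun x => G.Adj x y ∧ ¬ F.Adj x y).card + dg F y ≤ dg G y := by
  unfold dg
  rw [← Finset.card_union_of_disjoint]
  · refine Finset.card_le_card fun x => ?_
    simp only [Finset.mem_filter, Finset.mem_union, mem_nbrs]
    rintro (h | h)
    · exact h.2.1.symm
    · exact hle h
  · rw [Finset.disjoint_left]
    intro x
    simp only [Finset.mem_filter, mem_nbrs]
    exact fun h h' => h.2.2 h'.symm

open Classical in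
lemma card_old_eq_dg {y : V} (h : ∀ x, F.Adj x y → x ∈ D) :
    (D.filter (F.Adj · y)).card = dg F y := by
  unfold dg
  congr 1
  ext x
  simp only [Finset.mem_filter, mem_nbrs]
  exact ⟨fun h => h.2.symm, fun hx => ⟨h x hx.symm, hx.symm⟩⟩

/-- A vertex outside `A` without edges in `F` is not hit. -/
lemma State.dg_ne_zero_of_hit (hF : Start G A F v₀) (h : State G A F v₀ D S)
    (hno : ∀ v p, ¬ Gain G D S v p) {u y : V} (hu : u ∈ D) (huy : G.Adj u y)
    (hn : ¬ F.Adj u y) : dg F y ≠ 0 := by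
  intro hy
  have h1 := h.isolated u hu y ((hF.bip huy).1 (h.sub u hu)) hy
  refine hno u y ⟨hu, huy, h.notAdj_self hu hn, fun hr => ?_, by omega⟩
  obtain ⟨x, hx⟩ := exists_adj_of_reachable hr huy.ne
  have := one_le_dg hx
  omega

/-- When no move is left, one of the edges of `F` at a vertex that was hit leads to `D`. -/
lemma State.exists_mem_of_hit (hF : Start G A F v₀) (h : State G A F v₀ D S)
    (hall : ∀ v p q w, ¬ Move G A D S v p q w) {u y : V} (hu : u ∈ D)
    (huy : G.Adj u y) (hn : ¬ F.Adj u y) (hy : dg F y = 2) : ∃ x ∈ D, F.Adj x y := by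
  classical
  by_contra! hD
  have hyA : y ∉ A := (hF.bip huy).1 (h.sub u hu)
  -- The search has not altered unreached vertices of `A`. If both edges of `F` at `y` lead to such
  -- vertices, they are still in `S u`, and by the degree bound they are all its edges at `y`.
  have hin : ∀ {x}, F.Adj x y → (S u).Adj x y := fun {x} hx =>
    (h.out u hu x ((hF.bip (hF.le hx)).2 hyA) (fun hxD => hD x hxD hx) y).2 hx
  have hsub : nbrs F y ⊆ nbrs (S u) y := fun x hx => by
    simp only [mem_nbrs] at *
    exact (hin hx.symm).symm
  have h2 := (h.forest u hu).dg_le y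
  have heq : nbrs F y = nbrs (S u) y := Finset.eq_of_subset_of_card_le hsub (by
    unfold dg at hy h2; omega)
  have hdg : dg (S u) y = 2 := by unfold dg at *; rw [← heq]; exact hy
  have hmove : ∀ x, (S u).Adj y x → ¬ (cut (S u) y x).Reachable u y → False := by
    intro x hx hsep
    have hxF : F.Adj y x := by
      have : x ∈ nbrs F y := by rw [heq]; simpa
      simpa using this
    have hxD : x ∉ D := fun hxD => hD x hxD hxF.symm
    have := dg_cut hx y
    simp only [true_or, if_true] at this
    exact hall u y y x ⟨hu, huy, h.notAdj_self hu hn, hx,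
      (hF.bip (hF.le hxF.symm)).2 hyA, hxD, hsep,
      by omega⟩
  -- To free `y`, delete the edge by which the path from `u` arrives; if `u` and `y` are in
  -- different components, any edge at `y` will do.
  by_cases hr : (S u).Reachable u y
  · obtain ⟨x, hx, hsep⟩ := exists_last_edge (h.forest u hu).acyclic hr huy.ne
    exact hmove x hx hsep
  · obtain ⟨x, hx⟩ := exists_adj_of_one_le_dg (H := S u) (v := y) (by omega)
    exact hmove x hx fun hr' => hr (hr'.mono (cut_le _ _ _))

/-- Strictness comes from `v₀`, a reached vertex known to be deficient. -/
lemma sum_dg_lt (h : State G A F v₀ D S) (k : ℕ)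
    (hk : ∀ v ∈ A, dg F v ≤ k) (h0 : dg F v₀ < k) : ∑ x ∈ D, dg F x < k * D.card := by
  rw [mul_comm, ← smul_eq_mul, ← Finset.sum_const]
  exact Finset.sum_lt_sum (fun x hx => hk x (h.sub x hx)) ⟨v₀, h.start, h0⟩

/-- The search for a second edge at a vertex of degree four does not get stuck. -/
theorem State.exists_of_degree_four (hF : Start G A F v₀) (h : State G A F v₀ D S)
    (h4 : ∀ v ∈ A, dg G v = 4) (h3 : ∀ v ∉ A, dg G v = 3)
    (hcard : (Closed G F D S).ncard ≤ (Full A F D).ncard)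
    (hadj : ∀ a ∈ Closed G F D S, ∀ x, F.Adj x a → x ∈ D)
    (hno : ∀ v p, ¬ Gain G D S v p) : ∃ v p q w, Move G A D S v p q w := by
  classical
  by_contra! hall
  have hlt := sum_dg_lt h 2 (fun v _ => hF.forest.dg_le v) (by have := hF.deg; omega)
  have hsum := sum_dg_sub_eq hF.le D
  rw [Finset.sum_congr rfl fun x hx => h4 x (h.sub x hx), Finset.sum_const, smul_eq_mul] at hsum
  -- For a hit vertex `y` of degree 3: with one edge in `F` there are at most two new edges against
  -- one old, and `Closed` covers the difference; with two edges in `F` there is at most one new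
  -- edge, at least one old edge, and a second old one if `y` is full.
  have hpt : ∀ y, (D.filter fun x => G.Adj x y ∧ ¬ F.Adj x y).card +
      (if y ∈ Full A F D then 1 else 0) ≤
      (D.filter (F.Adj · y)).card + (if y ∈ Closed G F D S then 1 else 0) := by
    intro y
    have hle := card_new_add_dg_le hF.le D y
    have h2 := hF.forest.dg_le y
    rcases (D.filter fun x => G.Adj x y ∧ ¬ F.Adj x y).eq_empty_or_nonempty with he | ⟨u, hu⟩
    · rw [he, Finset.card_empty]
      by_cases hy : y ∈ Full A F D
      · rw [if_pos hy, card_old_eq_dg hy.2.2, hy.2.1]; omega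
      · rw [if_neg hy]; omega
    · simp only [Finset.mem_filter] at hu
      obtain ⟨huD, huy, huF⟩ := hu
      have hyA : y ∉ A := (hF.bip huy).1 (h.sub u huD)
      rw [h3 y hyA] at hle
      have h0 := h.dg_ne_zero_of_hit hF hno huD huy huF
      by_cases hy1 : dg F y = 1
      · have hy : y ∈ Closed G F D S := h.closed_of_hit hno hF huD huy huF hy1
        have hnf : y ∉ Full A F D := fun hf => by have := hf.2.1; omega
        rw [if_pos hy, if_neg hnf, card_old_eq_dg (hadj y hy)]
        omega
      · have hy2 : dg F y = 2 := by omega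
        by_cases hy : y ∈ Full A F D
        · rw [if_pos hy, card_old_eq_dg hy.2.2]; omega
        · rw [if_neg hy]
          obtain ⟨x, hxD, hx⟩ := h.exists_mem_of_hit hF hall huD huy huF hy2
          have : 0 < (D.filter (F.Adj · y)).card :=
            Finset.card_pos.2 ⟨x, by simp [hxD, hx]⟩
          omega
  -- With `hcard`, summation gives at most as many new as old edges, whereas together they number
  -- `4|D|` and the old ones fewer than `2|D|`.
  have hS := Finset.sum_le_sum fun y (_ : y ∈ Finset.univ) => hpt y
  rw [Finset.sum_add_distrib, Finset.sum_add_distrib, Finset.sum_boole, Finset.sum_boole,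
    ← sum_dg_eq] at hS
  have e1 : (Finset.univ.filter fun y => y ∈ Full A F D).card = (Full A F D).ncard := by
    rw [← Set.ncard_coe_finset]; simp
  have e2 : (Finset.univ.filter fun y => y ∈ Closed G F D S).card = (Closed G F D S).ncard := by
    rw [← Set.ncard_coe_finset]; simp
  rw [e1, e2] at hS
  simp only [Nat.cast_id] at hS
  omega

/-- The search for a first edge at a vertex of degree three does not get stuck. -/
theorem State.exists_of_degree_three (hF : Start G A F v₀) (h : State G A F v₀ D S)
    (h3 : ∀ v ∈ A, dg G v = 3) (h4 : ∀ v ∉ A, dg G v = 4)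
    (h1 : ∀ v ∈ A, dg F v ≤ 1) (h0 : dg F v₀ = 0)
    (hno : ∀ v p, ¬ Gain G D S v p) : ∃ v p q w, Move G A D S v p q w := by
  classical
  by_contra! hall
  -- The degree balance leaves `u` no edge in `S u`, since degrees in `F` are at most one on `A` and
  -- zero at `v₀`.
  have hiso : ∀ u ∈ D, ∀ y, (S u).Reachable u y → u = y := by
    intro u hu y hr
    by_contra hne
    have e1 := h.deg_mem u hu u (h.sub u hu)
    have e2 := h1 u (h.sub u hu)
    obtain ⟨x, hx⟩ := exists_adj_of_reachable hr.symm (Ne.symm hne)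
    have e3 := one_le_dg hx
    rw [if_pos rfl] at e1
    split_ifs at e1 with he
    · rw [he] at e1 e3; omega
    · omega
  have hlt := sum_dg_lt h 1 h1 (by omega)
  have hsum := sum_dg_sub_eq hF.le D
  rw [Finset.sum_congr rfl fun x hx => h3 x (h.sub x hx), Finset.sum_const, smul_eq_mul] at hsum
  -- A hit vertex with one edge in `F` would be closed, hence joined to an isolated vertex. With two
  -- edges in `F`, both come from `D`, or deleting one would give a move, and at most two of the
  -- four edges at `y` are new.
  have hpt : ∀ y, (D.filter fun x => G.Adj x y ∧ ¬ F.Adj x y).card ≤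
      (D.filter (F.Adj · y)).card := by
    intro y
    have hle := card_new_add_dg_le hF.le D y
    have h2 := hF.forest.dg_le y
    rcases (D.filter fun x => G.Adj x y ∧ ¬ F.Adj x y).eq_empty_or_nonempty with he | ⟨u, hu⟩
    · rw [he, Finset.card_empty]; omega
    simp only [Finset.mem_filter] at hu
    obtain ⟨huD, huy, huF⟩ := hu
    have hyA : y ∉ A := (hF.bip huy).1 (h.sub u huD)
    rw [h4 y hyA] at hle
    have h0 := h.dg_ne_zero_of_hit hF hno huD huy huF
    by_cases hy1 : dg F y = 1
    · obtain ⟨-, v, hv, -, hvF, hr, -⟩ := h.closed_of_hit hno hF huD huy huF hy1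
      have := hiso v hv y hr
      exact absurd (this ▸ h.sub v hv) hyA
    have hy2 : dg F y = 2 := by omega
    rw [card_old_eq_dg, hy2]
    · omega
    intro x hx
    by_contra hxD
    have hxA : x ∈ A := (hF.bip (hF.le hx)).2 hyA
    have hxS : (S u).Adj x y := (h.out u huD x hxA hxD y).2 hx
    have e1 := dg_cut hxS.symm y
    have e2 := (h.forest u huD).dg_le y
    simp only [true_or, if_true] at e1
    exact hall u y y x ⟨huD, huy, h.notAdj_self huD huF, hxS.symm, hxA, hxD,
      fun hr => huy.ne (hiso u huD y (hr.mono (cut_le _ _ _))), by omega⟩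
  have hS := Finset.sum_le_sum fun y (_ : y ∈ Finset.univ) => hpt y
  rw [← sum_dg_eq] at hS
  omega

end AugSearch

/-! ### Linear forests as path factors -/

section PathFactor

variable {V : Type*} [Fintype V]

lemma encard_neighborSet (G : SimpleGraph V) (v : V) : (G.neighborSet v).encard = dg G v := by
  have : G.neighborSet v = (nbrs G v : Set V) := by ext w; simp
  rw [this, Set.encard_coe_eq_coe_finsetCard, dg]

/-- All neighbours of the start lie on the path, as it cannot be prolonged, and acyclicity admits
only the second vertex. -/
lemma dg_start_le_one_of_longest {F : SimpleGraph V} (hF : F.IsAcyclic) {u v : V} {p : F.Walk u v}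
    (hp : p.IsPath) (hmax : ∀ w (q : F.Walk w v), q.IsPath → q.length ≤ p.length) :
    dg F u ≤ 1 := by
  by_contra! h
  obtain ⟨a, ha, b, hb, hab⟩ := Finset.one_lt_card.1 h
  rw [mem_nbrs] at ha hb
  have key : ∀ w, F.Adj u w → w = p.snd := by
    intro w hw
    by_cases hwp : w ∈ p.support
    · exact hF.eq_snd_of_adj_start hp hw hwp
    · have := hmax w (SimpleGraph.Walk.cons hw.symm p) (hp.cons hwp)
      simp at this
  exact hab ((key a ha).trans (key b hb).symm)

/-- A path that cannot be prolonged spans its component. -/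
lemma exists_spanning_path {F : SimpleGraph V} (hF : F.IsAcyclic) (hpos : ∀ v, 1 ≤ dg F v) (c : V) :
    ∃ (u v : V) (p : F.Walk u v), p.IsPath ∧ F.Reachable c u ∧ u ≠ v ∧ dg F u ≤ 1 ∧ dg F v ≤ 1 := by
  classical
  -- A longest path in the component of `c` is taken. Its length is at least one because `c` is not
  -- isolated, which makes its ends distinct.
  let P : ℕ → Prop := fun l =>
    ∃ (u v : V) (p : F.Walk u v), p.IsPath ∧ F.Reachable c u ∧ p.length = l
  have hP : ∀ l, P l → l ≤ Fintype.card V := by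
    rintro l ⟨u, v, p, hp, -, rfl⟩
    exact hp.length_lt.le
  obtain ⟨d, hd⟩ := exists_adj_of_one_le_dg (hpos c)
  have h1 : P 1 := ⟨c, d, SimpleGraph.Walk.cons hd SimpleGraph.Walk.nil, by simp [hd.ne],
    SimpleGraph.Reachable.refl _, rfl⟩
  have hspec := Nat.findGreatest_spec (P := P) (hP 1 h1) h1
  have hge := Nat.le_findGreatest (P := P) (hP 1 h1) h1
  obtain ⟨u, v, p, hp, hcu, hl⟩ := hspec
  have hmax : ∀ (u' v' : V) (q : F.Walk u' v'), q.IsPath → F.Reachable c u' →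
      q.length ≤ p.length := by
    intro u' v' q hq hr
    rw [hl]
    exact Nat.le_findGreatest (hP _ ⟨u', v', q, hq, hr, rfl⟩) ⟨u', v', q, hq, hr, rfl⟩
  refine ⟨u, v, p, hp, hcu, ?_, ?_, ?_⟩
  · rintro rfl
    have := SimpleGraph.Walk.length_eq_zero_iff.2 (SimpleGraph.Walk.isPath_iff_nil.1 hp)
    omega
  · exact dg_start_le_one_of_longest hF hp fun w q hq =>
      hmax w v q hq (hcu.trans (p.reachable.trans q.reachable.symm))
  · refine dg_start_le_one_of_longest hF hp.reverse fun w q hq => ?_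
    rw [SimpleGraph.Walk.length_reverse, ← SimpleGraph.Walk.length_reverse q]
    exact hmax u w q.reverse hq.reverse hcu

/-- The components of a linear forest without isolated vertices are paths. -/
theorem IsLinForest.exists_iso {F : SimpleGraph V} (hF : IsLinForest F) (hpos : ∀ v, 1 ≤ dg F v)
    (C : F.ConnectedComponent) :
    ∃ l : ℕ, 1 ≤ l ∧ Nonempty (SimpleGraph.pathGraph (l + 1) ≃g C.toSimpleGraph) := by
  classical
  induction C using SimpleGraph.ConnectedComponent.ind with | _ c => ?_
  obtain ⟨u, v, p, hp, hcu, hne, hu, hv⟩ := exists_spanning_path hF.acyclic hpos c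
  have hmem : ∀ i, p.getVert i ∈ F.connectedComponentMk c := by
    intro i
    refine SimpleGraph.ConnectedComponent.sound ?_
    exact (hcu.trans (p.take i).reachable).symm
  have hinj : ∀ i j, i ≤ p.length → j ≤ p.length → p.getVert i = p.getVert j → i = j :=
    fun i j hi hj h => hp.getVert_injOn hi hj h
  let f : Fin (p.length + 1) → F.connectedComponentMk c := fun i => ⟨p.getVert i, hmem i⟩
  have hf : Function.Bijective f := by
    constructor
    · intro i j hij
      exact Fin.ext (hinj i j (by omega) (by omega) (congrArg Subtype.val hij))
    · rintro ⟨x, hx⟩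
      have hxr : F.Reachable u x := by
        exact hcu.symm.trans (SimpleGraph.ConnectedComponent.exact hx).symm
      obtain ⟨i, hi, hil⟩ := SimpleGraph.Walk.mem_support_iff_exists_getVert.1
        (mem_support_of_reachable hF.dg_le hne hp hu hv hxr)
      exact ⟨⟨i, by omega⟩, Subtype.ext hi⟩
  refine ⟨p.length, ?_, ⟨⟨Equiv.ofBijective f hf, ?_⟩⟩⟩
  · rw [Nat.one_le_iff_ne_zero]
    exact fun h0 => hne (SimpleGraph.Walk.eq_of_length_eq_zero h0)
  · intro i j
    change F.Adj (p.getVert i) (p.getVert j) ↔ _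
    rw [SimpleGraph.pathGraph_adj]
    constructor
    · intro hadj
      have he := mem_edges_of_mem_support hF.dg_le hne hp hu hv (p.getVert_mem_support i) hadj
      rw [← SimpleGraph.Walk.mem_edges_toSubgraph, SimpleGraph.Subgraph.mem_edgeSet,
        SimpleGraph.Walk.toSubgraph_adj_iff] at he
      obtain ⟨k, hk, hkl⟩ := he
      rw [Sym2.eq_iff] at hk
      rcases hk with ⟨h1, h2⟩ | ⟨h1, h2⟩
      · have := hinj _ _ (by omega) (by omega) h1
        have := hinj _ _ (by omega) (by omega) h2
        omega
      · have := hinj _ _ (by omega) (by omega) h1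
        have := hinj _ _ (by omega) (by omega) h2
        omega
    · rintro (h | h)
      · rw [← h]; exact p.adj_getVert_succ (by omega)
      · rw [← h]; exact (p.adj_getVert_succ (by omega)).symm

/-- Neighbours of a vertex stay in its component, so they correspond to neighbours in the path
graph, of which an end has at most one. -/
lemma dg_le_one_of_pathGraph {F : SimpleGraph V} {C : F.ConnectedComponent} {l : ℕ}
    (f : SimpleGraph.pathGraph (l + 1) ≃g C.toSimpleGraph) {i : Fin (l + 1)}
    (hi : i = 0 ∨ i = Fin.last l) : dg F (f i) ≤ 1 := by
  refine Finset.card_le_one.2 fun a ha b hb => ?_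
  rw [mem_nbrs] at ha hb
  have key : ∀ a, F.Adj (f i) a → ∃ j, (f j : V) = a ∧ (SimpleGraph.pathGraph (l + 1)).Adj i j := by
    intro a ha
    have haC : a ∈ C := by
      have h1 : F.connectedComponentMk (f i) = C := (f i).2
      have h2 : F.connectedComponentMk a = C :=
        (SimpleGraph.ConnectedComponent.sound ha.symm.reachable).trans h1
      exact h2
    obtain ⟨j, hj⟩ := f.surjective ⟨a, haC⟩
    refine ⟨j, by rw [hj], f.map_adj_iff.1 ?_⟩
    rw [hj]
    exact ha
  obtain ⟨j, rfl, hj⟩ := key a ha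
  obtain ⟨k, rfl, hk⟩ := key b hb
  rw [SimpleGraph.pathGraph_adj] at hj hk
  have : j = k := by
    have h1 := j.2
    have h2 := k.2
    rcases hi with rfl | rfl
    · ext; simp at hj hk; omega
    · ext; simp at hj hk; omega
  rw [this]

/-- What the algorithm is to achieve. -/
structure IsWanted (G F : SimpleGraph V) : Prop where
  le : F ≤ G
  forest : IsLinForest F
  pos : ∀ v, 1 ≤ dg F v
  two : ∀ v, dg G v = 4 → dg F v = 2

theorem IsWanted.isPathFactor {G F : SimpleGraph V} (h : IsWanted G F)
    (hG : ∀ v, dg G v = 3 ∨ dg G v = 4) : IsPathFactor G F ∧ PathEndpointsHaveDegree 3 G F := by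
  refine ⟨⟨h.le, h.forest.exists_iso h.pos⟩, fun C l f => ?_⟩
  have key : ∀ v, dg F v ≤ 1 → (G.neighborSet v).encard = (3 : ℕ) := by
    intro v hv
    rw [encard_neighborSet]
    rcases hG v with h3 | h4
    · rw [h3]
    · have := h.two v h4
      omega
  exact ⟨key _ (dg_le_one_of_pathGraph f (Or.inl rfl)),
    key _ (dg_le_one_of_pathGraph f (Or.inr rfl))⟩

/-- The sides are recovered from the degrees, so the program never needs the bipartition as input.
-/
lemma IsBiregularBigraph.dg_eq {G : SimpleGraph V} (h : IsBiregularBigraph 3 4 G) :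
    (∀ v, dg G v = 3 ∨ dg G v = 4) ∧ ∀ ⦃u v⦄, G.Adj u v → (dg G u = 3 ↔ dg G v ≠ 3) := by
  obtain ⟨Y, X, hbip, hun, hY, hX⟩ := h
  have hY' : ∀ y ∈ Y, dg G y = 3 := fun y hy => by
    have := hY y hy
    rw [encard_neighborSet] at this
    exact_mod_cast this
  have hX' : ∀ x ∈ X, dg G x = 4 := fun x hx => by
    have := hX x hx
    rw [encard_neighborSet] at this
    exact_mod_cast this
  refine ⟨fun v => ?_, fun u v huv => ?_⟩
  · have hv : v ∈ Y ∪ X := hun ▸ Set.mem_univ v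
    exact hv.imp (hY' v) (hX' v)
  · rcases hbip.mem_of_adj huv with ⟨h1, h2⟩ | ⟨h1, h2⟩
    · rw [hY' _ h1, hX' _ h2]; simp
    · rw [hX' _ h1, hY' _ h2]; simp

/-! ### Transport along a bijection of vertex sets -/

variable {W : Type*} [Fintype W]

lemma dg_comap (e : V ≃ W) (H : SimpleGraph W) (v : V) : dg (H.comap e) v = dg H (e v) :=
  Finset.card_equiv e fun w => by simp

lemma IsWanted.comap {G : SimpleGraph V} (e : V ≃ W) {F : SimpleGraph W}
    (h : IsWanted (G.comap e.symm) F) : IsWanted G (F.comap e) where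
  le := by
    intro a b hab
    have := h.le hab
    simpa using this
  forest := ⟨h.forest.acyclic.comap ⟨e, fun h => h⟩ e.injective,
    fun v => by rw [dg_comap]; exact h.forest.dg_le _⟩
  pos v := by rw [dg_comap]; exact h.pos _
  two v hv := by
    rw [dg_comap]
    refine h.two _ ?_
    rw [dg_comap]
    simpa using hv

lemma IsBiregularBigraph.comap {G : SimpleGraph V} (e : W ≃ V) {a b : ℕ}
    (h : IsBiregularBigraph a b G) : IsBiregularBigraph a b (G.comap e) := by
  have henc : ∀ w, ((G.comap e).neighborSet w).encard = (G.neighborSet (e w)).encard := fun w => by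
    rw [encard_neighborSet, encard_neighborSet, dg_comap]
  obtain ⟨Y, X, hbip, hun, hY, hX⟩ := h
  refine ⟨e ⁻¹' Y, e ⁻¹' X, ⟨hbip.disjoint.preimage e, fun _ _ hab => hbip.mem_of_adj hab⟩, ?_,
    fun y hy => ?_, fun x hx => ?_⟩
  · rw [← Set.preimage_union, hun, Set.preimage_univ]
  · rw [henc]; exact hY _ hy
  · rw [henc]; exact hX _ hx

end PathFactor

/-! ### Programs with bounded loops -/

namespace ArrayMachine

/-- Programs in which all loops run a counter, held in array `3`, up to the entry `(0, 0)` of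
array `1`. -/
inductive Cmd : Type
  | skip
  | store (a : ℕ) (i j e : Expr)
  | seq (p q : Cmd)
  | ite (b : Test) (p q : Cmd)
  | rep (c : ℕ) (p : Cmd)

namespace Cmd

/-- The expression reading a counter. -/
abbrev ctr (c : ℕ) : Expr := .get 3 (.lit 0) (.lit c)

/-- Translation into the machine language. -/
def toProgram : Cmd → Program
  | skip => .skip
  | store a i j e => .store a i j e
  | seq p q => .seq p.toProgram q.toProgram
  | ite b p q => .ite b p.toProgram q.toProgram
  | rep c p => .seq (.store 3 (.lit 0) (.lit c) (.lit 0))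
      (.loop (.lt (ctr c) (.get 1 (.lit 0) (.lit 0)))
        (.seq p.toProgram (.store 3 (.lit 0) (.lit c) (.succ (ctr c)))))

/-- The memory after increasing a counter. -/
def tick (c : ℕ) (M : Memory) : Memory := M.write 3 0 c (M 3 0 c + 1)

/-- The memory after the execution. -/
def den : Cmd → Memory → Memory
  | skip, M => M
  | store a i j e, M => M.write a (i.eval M) (j.eval M) (e.eval M)
  | seq p q, M => q.den (p.den M)
  | ite b p q, M => cond (b.eval M) (p.den M) (q.den M)
  | rep c p, M => (fun M => tick c (p.den M))^[M 1 0 0] (M.write 3 0 c 0)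

/-- A bound for the number of steps. -/
noncomputable def cost : Cmd → Polynomial ℕ
  | skip => 1
  | store _ _ _ _ => 1
  | seq p q => 1 + p.cost + q.cost
  | ite _ p q => 1 + p.cost + q.cost
  | rep _ p => 3 + Polynomial.X * (p.cost + 3)

/-- The array `a` is written by the program. -/
def writes (a : ℕ) : Cmd → Bool
  | skip => false
  | store b _ _ _ => a == b
  | seq p q => p.writes a || q.writes a
  | ite _ p q => p.writes a || q.writes a
  | rep _ p => a == 3 || p.writes a

/-- The counter `c` is changed by the program. -/
def counts (c : ℕ) : Cmd → Bool
  | skip => false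
  | store b _ _ _ => b == 3
  | seq p q => p.counts c || q.counts c
  | ite _ p q => p.counts c || q.counts c
  | rep c' p => c == c' || p.counts c

/-- Array `1` is not changed, and no loop changes the counter of a surrounding one. -/
def safe : Cmd → Bool
  | skip => true
  | store b _ _ _ => b != 1
  | seq p q => p.safe && q.safe
  | ite _ p q => p.safe && q.safe
  | rep c p => p.safe && !p.counts c

/-! ### Frame properties: what a command leaves unchanged -/

lemma _root_.ArrayMachine.Memory.write_of_ne {M : Memory} {a b i j v : ℕ} (h : b ≠ a) :
    M.write a i j v b = M b := by
  funext i' j'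
  simp [Memory.write, h]

lemma _root_.ArrayMachine.Memory.write_eq {M : Memory} {a i j v i' j' : ℕ} :
    M.write a i j v a i' j' = if i' = i ∧ j' = j then v else M a i' j' := by
  simp [Memory.write]

lemma tick_of_ne {c a : ℕ} {M : Memory} (h : a ≠ 3) : tick c M a = M a := Memory.write_of_ne h

/-- The hypothesis is a syntactic check, which `rfl` settles for the concrete subroutines. -/
lemma den_of_not_writes {a : ℕ} (p : Cmd) (h : p.writes a = false) (M : Memory) :
    p.den M a = M a := by
  induction p generalizing M with
  | skip => rfl
  | store b i j e =>
    simp only [writes, beq_eq_false_iff_ne] at h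
    exact Memory.write_of_ne h
  | seq p q ihp ihq =>
    simp only [writes, Bool.or_eq_false_iff] at h
    exact (ihq h.2 _).trans (ihp h.1 M)
  | ite b p q ihp ihq =>
    simp only [writes, Bool.or_eq_false_iff] at h
    rw [den]
    cases b.eval M
    · exact ihq h.2 M
    · exact ihp h.1 M
  | rep c p ih =>
    simp only [writes, Bool.or_eq_false_iff, beq_eq_false_iff_ne] at h
    rw [den]
    generalize M 1 0 0 = k
    induction k with
    | zero => exact Memory.write_of_ne h.1
    | succ k ihk =>
      rw [Function.iterate_succ_apply']
      exact (tick_of_ne h.1).trans ((ih h.2 _).trans ihk)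

lemma den_of_not_counts {c : ℕ} (p : Cmd) (h : p.counts c = false) (M : Memory) :
    p.den M 3 0 c = M 3 0 c := by
  induction p generalizing M with
  | skip => rfl
  | store b i j e =>
    simp only [counts, beq_eq_false_iff_ne] at h
    rw [den, Memory.write_of_ne (Ne.symm h)]
  | seq p q ihp ihq =>
    simp only [counts, Bool.or_eq_false_iff] at h
    exact (ihq h.2 _).trans (ihp h.1 M)
  | ite b p q ihp ihq =>
    simp only [counts, Bool.or_eq_false_iff] at h
    rw [den]
    cases b.eval M
    · exact ihq h.2 M
    · exact ihp h.1 M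
  | rep c' p ih =>
    simp only [counts, Bool.or_eq_false_iff, beq_eq_false_iff_ne] at h
    rw [den]
    generalize M 1 0 0 = k
    induction k with
    | zero => simp [Memory.write, h.1]
    | succ k ihk =>
      rw [Function.iterate_succ_apply', ← ihk]
      refine Eq.trans ?_ (ih h.2 _)
      simp [tick, Memory.write, h.1]

lemma den_one_of_safe {p : Cmd} (h : p.safe) (M : Memory) : p.den M 1 = M 1 := by
  refine den_of_not_writes p ?_ M
  induction p with
  | skip => rfl
  | store b i j e =>
    simp only [safe, bne_iff_ne] at h
    simpa only [writes, beq_eq_false_iff_ne] using h.symm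
  | seq p q ihp ihq =>
    simp only [safe, Bool.and_eq_true] at h
    simp [writes, ihp h.1, ihq h.2]
  | ite b p q ihp ihq =>
    simp only [safe, Bool.and_eq_true] at h
    simp [writes, ihp h.1, ihq h.2]
  | rep c p ih =>
    simp only [safe, Bool.and_eq_true] at h
    simp [writes, ih h.1]

/-! ### Step counts and loop invariants -/

/-- Executing `p` before `k` takes at most `t` steps and leads from `M` to `M'`. -/
def Runs (p : Program) (M : Memory) (t : ℕ) (M' : Memory) : Prop :=
  ∃ s ≤ t, ∀ k, step^[s] (p :: k, M) = (k, M')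

lemma Runs.seq {p q : Program} {M M₁ M₂ : Memory} {s t : ℕ} (hp : Runs p M s M₁)
    (hq : Runs q M₁ t M₂) : Runs (.seq p q) M (1 + s + t) M₂ := by
  obtain ⟨s', hs', hp⟩ := hp
  obtain ⟨t', ht', hq⟩ := hq
  refine ⟨t' + (s' + 1), by omega, fun k => ?_⟩
  rw [Function.iterate_add_apply, Function.iterate_succ_apply]
  change step^[t'] (step^[s'] (p :: q :: k, M)) = _
  rw [hp, hq]

lemma Runs.store (a : ℕ) (i j e : Expr) (M : Memory) :
    Runs (.store a i j e) M 1 (M.write a (i.eval M) (j.eval M) (e.eval M)) :=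
  ⟨1, le_rfl, fun _ => rfl⟩

lemma Runs.mono {p : Program} {M M' : Memory} {s t : ℕ} (h : Runs p M s M') (hst : s ≤ t) :
    Runs p M t M' := by
  obtain ⟨s', hs', h⟩ := h
  exact ⟨s', hs'.trans hst, h⟩

lemma Runs.loop_false {b : Test} {p : Program} {M : Memory} (h : b.eval M = false) :
    Runs (.loop b p) M 1 M := ⟨1, le_rfl, fun k => by simp [step, h]⟩

lemma Runs.loop_true {b : Test} {p : Program} {M M₁ M₂ : Memory} {s t : ℕ}
    (h : b.eval M = true) (hp : Runs p M s M₁) (hq : Runs (.loop b p) M₁ t M₂) :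
    Runs (.loop b p) M (1 + s + t) M₂ := by
  obtain ⟨s', hs', hp⟩ := hp
  obtain ⟨t', ht', hq⟩ := hq
  refine ⟨t' + (s' + 1), by omega, fun k => ?_⟩
  rw [Function.iterate_add_apply, Function.iterate_succ_apply]
  have : step (.loop b p :: k, M) = (p :: .loop b p :: k, M) := by simp [step, h]
  rw [this, hp, hq]

/-- The body of a counting loop, started when the counter is `i`. -/
lemma Runs.count {p : Program} {f : Memory → Memory} {c n t : ℕ}
    (hp : ∀ M : Memory, M 1 0 0 = n → Runs p M t (f M))
    (h1 : ∀ M, f M 1 = M 1) (hc : ∀ M, f M 3 0 c = M 3 0 c) (k i : ℕ) (hik : i + k = n) (M : Memory)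
    (hM : M 1 0 0 = n) (hMc : M 3 0 c = i) :
    Runs (.loop (.lt (ctr c) (.get 1 (.lit 0) (.lit 0)))
        (.seq p (.store 3 (.lit 0) (.lit c) (.succ (ctr c))))) M (1 + k * (t + 3))
      ((fun M => tick c (f M))^[k] M) := by
  induction k generalizing i M with
  | zero =>
    rw [zero_mul, add_zero]
    exact Runs.loop_false (by simp [Test.eval, Expr.eval, hM, hMc, ← hik])
  | succ k ih =>
    have hb : Test.eval M (.lt (ctr c) (.get 1 (.lit 0) (.lit 0))) = true := by
      simp [Test.eval, Expr.eval, hM, hMc, ← hik]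
    have h2 := ih (i + 1) (by omega) (tick c (f M)) (by rw [tick_of_ne (by decide), h1, hM])
      (by simp [tick, Memory.write, hc, hMc])
    rw [Function.iterate_succ_apply]
    refine (Runs.loop_true hb ((hp M hM).seq (Runs.store _ _ _ _ _)) h2).mono ?_
    ring_nf
    omega

/-- Safe commands never change array `1`, so all loops share the bound `n`, and the costs of the
parts are polynomials evaluated at the same `n`. -/
theorem runs (p : Cmd) (h : p.safe) (M : Memory) :
    Runs p.toProgram M (p.cost.eval (M 1 0 0)) (p.den M) := by
  induction p generalizing M with
  | skip => exact ⟨1, by simp [cost], fun k => rfl⟩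
  | store a i j e => exact (Runs.store a i j e M).mono (by simp [cost])
  | seq p q ihp ihq =>
    simp only [safe, Bool.and_eq_true] at h
    refine ((ihp h.1 M).seq (ihq h.2 _)).mono ?_
    rw [den_one_of_safe h.1, cost, Polynomial.eval_add, Polynomial.eval_add, Polynomial.eval_one]
  | ite b p q ihp ihq =>
    simp only [safe, Bool.and_eq_true] at h
    obtain ⟨s, hs, hp⟩ := ihp h.1 M
    obtain ⟨t, ht, hq⟩ := ihq h.2 M
    rw [cost, Polynomial.eval_add, Polynomial.eval_add, Polynomial.eval_one, den]
    rcases hb : b.eval M with _ | _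
    · refine ⟨t + 1, by omega, fun k => ?_⟩
      rw [Function.iterate_succ_apply, toProgram]
      simp only [step, hb, cond_false, hq]
    · refine ⟨s + 1, by omega, fun k => ?_⟩
      rw [Function.iterate_succ_apply, toProgram]
      simp only [step, hb, cond_true, hp]
  | rep c p ih =>
    simp only [safe, Bool.and_eq_true, Bool.not_eq_true'] at h
    have key := Runs.count (p := p.toProgram) (f := p.den) (c := c) (n := M 1 0 0)
      (fun M' hM' => hM' ▸ ih h.1 M') (fun M => den_one_of_safe h.1 M)
      (fun M => den_of_not_counts p h.2 M) (M 1 0 0) 0 (zero_add _) (M.write 3 0 c 0)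
      (by rw [Memory.write_of_ne (by decide)]) (by simp [Memory.write])
    refine ((Runs.store 3 (.lit 0) (.lit c) (.lit 0) M).seq key).mono ?_
    simp only [cost, Polynomial.eval_add, Polynomial.eval_mul, Polynomial.eval_X,
      Polynomial.eval_ofNat]
    omega

/-- A configuration with nothing left to execute is a fixed point of `step`, so spare steps are
harmless. -/
lemma Runs.haltsWithin {p : Program} {M M' : Memory} {t : ℕ} (h : Runs p M t M') :
    HaltsWithin p M t M' := by
  obtain ⟨s, hs, h⟩ := h
  obtain ⟨d, rfl⟩ := Nat.exists_eq_add_of_le' hs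
  rw [HaltsWithin, Function.iterate_add_apply, h]
  exact Function.iterate_fixed rfl d

/-- Loops are analysed by an invariant. -/
theorem den_rep {c : ℕ} {p : Cmd} {n : ℕ} (hp : p.counts c = false) (Inv : ℕ → Memory → Prop)
    {M : Memory} (hn : M 1 0 0 = n) (h0 : Inv 0 (M.write 3 0 c 0))
    (hstep : ∀ i < n, ∀ M, M 3 0 c = i → Inv i M → Inv (i + 1) ((p.den M).write 3 0 c (i + 1))) :
    Inv n ((rep c p).den M) := by
  rw [den, hn]
  have key : ∀ k ≤ n, Inv k ((fun M => tick c (p.den M))^[k] (M.write 3 0 c 0)) ∧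
      (fun M => tick c (p.den M))^[k] (M.write 3 0 c 0) 3 0 c = k := by
    intro k
    induction k with
    | zero => exact fun _ => ⟨h0, by simp [Memory.write]⟩
    | succ k ih =>
      intro hk
      obtain ⟨h1, h2⟩ := ih (by omega)
      have h3 := hstep k (by omega) _ h2 h1
      rw [Function.iterate_succ_apply']
      have h4 := den_of_not_counts p hp ((fun M => tick c (p.den M))^[k] (M.write 3 0 c 0))
      rw [h2] at h4
      rw [tick, h4]
      exact ⟨h3, by simp [Memory.write]⟩
  exact (key n le_rfl).1

end Cmd

end ArrayMachine

/-! ### Subroutines -/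

namespace ArrayMachine

namespace Cmd

variable {n : ℕ}

open Classical in
/-- Array `a` holds the adjacency matrix of `H`. -/
def IsMat (M : Memory) (a : ℕ) (H : SimpleGraph (Fin n)) : Prop :=
  ∀ i j : Fin n, M a i j = if H.Adj i j then 1 else 0

open Classical in
/-- Row `v` of array `6`, indexed by the codes of pairs in array `5`, holds `H`. -/
def IsRow (M : Memory) (v : ℕ) (H : SimpleGraph (Fin n)) : Prop :=
  ∀ i j : Fin n, M 6 v (M 5 i j) = if H.Adj i j then 1 else 0

lemma IsMat.congr {M M' : Memory} {a : ℕ} {H : SimpleGraph (Fin n)} (h : IsMat M a H)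
    (ha : M' a = M a) : IsMat M' a H := fun i j => by rw [ha]; exact h i j

lemma IsRow.congr {M M' : Memory} {v : ℕ} {H : SimpleGraph (Fin n)} (h : IsRow M v H)
    (h5 : M' 5 = M 5) (h6 : M' 6 v = M 6 v) : IsRow M' v H :=
  fun i j => by rw [h5, h6]; exact h i j

lemma IsMat.eq_one_iff {M : Memory} {a : ℕ} {H : SimpleGraph (Fin n)} (h : IsMat M a H)
    (i j : Fin n) : M a i j = 1 ↔ H.Adj i j := by
  rw [h i j]; split_ifs <;> simp_all

lemma IsRow.eq_one_iff {M : Memory} {v : ℕ} {H : SimpleGraph (Fin n)} (h : IsRow M v H)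
    (i j : Fin n) : M 6 v (M 5 i j) = 1 ↔ H.Adj i j := by
  rw [h i j]; split_ifs <;> simp_all

lemma IsRow.eq_zero_iff {M : Memory} {v : ℕ} {H : SimpleGraph (Fin n)} (h : IsRow M v H)
    (i j : Fin n) : M 6 v (M 5 i j) = 0 ↔ ¬ H.Adj i j := by
  rw [h i j]; split_ifs <;> simp_all

/-- Conditional execution. -/
def guard (b : Test) (p : Cmd) : Cmd := ite b p skip

lemma den_guard_of_true {b : Test} {p : Cmd} {M : Memory} (h : b.eval M = true) :
    (guard b p).den M = p.den M := by simp [guard, den, h]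

lemma den_guard_of_false {b : Test} {p : Cmd} {M : Memory} (h : b.eval M = false) :
    (guard b p).den M = M := by simp [guard, den, h]

/-- Storing the values of an expression for all pairs of indices. -/
def fill (a : ℕ) (I J E : Expr) : Cmd := rep 6 (rep 7 (store a I J E))

/-- `hI` makes the three expressions independent of what the loop has already written, and `hinj`
keeps later writes from destroying earlier ones. -/
lemma den_fill {a : ℕ} {I J E : Expr} {M : Memory} (hn : M 1 0 0 = n) (h1 : a ≠ 1) (h3 : a ≠ 3)
    {fI fJ fE : ℕ → ℕ → ℕ}
    (hI : ∀ (M' : Memory) (i j : ℕ), i < n → j < n → (∀ b, b ≠ a → b ≠ 3 → M' b = M b) →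
      (∀ c, c ≠ 6 → c ≠ 7 → M' 3 0 c = M 3 0 c) → M' 3 0 6 = i → M' 3 0 7 = j →
      I.eval M' = fI i j ∧ J.eval M' = fJ i j ∧ E.eval M' = fE i j)
    (hinj : ∀ i < n, ∀ j < n, ∀ i' < n, ∀ j' < n, fI i j = fI i' j' → fJ i j = fJ i' j' →
      i = i' ∧ j = j') :
    (∀ i < n, ∀ j < n, (fill a I J E).den M a (fI i j) (fJ i j) = fE i j) ∧
      ∀ x y, (∀ i < n, ∀ j < n, ¬ (fI i j = x ∧ fJ i j = y)) →
        (fill a I J E).den M a x y = M a x y := by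
  let Fr : Memory → Prop := fun M' => (∀ b, b ≠ a → b ≠ 3 → M' b = M b) ∧
    (∀ c, c ≠ 6 → c ≠ 7 → M' 3 0 c = M 3 0 c) ∧
    ∀ x y, (∀ i < n, ∀ j < n, ¬ (fI i j = x ∧ fJ i j = y)) → M' a x y = M a x y
  have hFr6 : ∀ {M' : Memory} {v : ℕ}, Fr M' → Fr (M'.write 3 0 6 v) := by
    rintro M' v ⟨f1, f2, f3⟩
    refine ⟨fun b hb hb3 => ?_, fun c hc hc7 => ?_, fun x y hxy => ?_⟩
    · rw [Memory.write_of_ne hb3]; exact f1 b hb hb3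
    · rw [Memory.write_eq, if_neg (by simp [hc])]; exact f2 c hc hc7
    · rw [Memory.write_of_ne h3]; exact f3 x y hxy
  have hFr7 : ∀ {M' : Memory} {v : ℕ}, Fr M' → Fr (M'.write 3 0 7 v) := by
    rintro M' v ⟨f1, f2, f3⟩
    refine ⟨fun b hb hb3 => ?_, fun c hc hc7 => ?_, fun x y hxy => ?_⟩
    · rw [Memory.write_of_ne hb3]; exact f1 b hb hb3
    · rw [Memory.write_eq, if_neg (by simp [hc7])]; exact f2 c hc hc7
    · rw [Memory.write_of_ne h3]; exact f3 x y hxy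
  have main := den_rep (c := 6) (p := rep 7 (store a I J E)) (by simp [counts, h3])
    (fun i M' => Fr M' ∧ ∀ i' < i, ∀ j < n, i' < n → M' a (fI i' j) (fJ i' j) = fE i' j) hn
    ⟨hFr6 ⟨fun _ _ _ => rfl, fun _ _ _ => rfl, fun _ _ _ => rfl⟩, by simp⟩ ?_
  · exact ⟨fun i hi j hj => main.2 i hi j hj hi, main.1.2.2⟩
  · rintro i hi M₁ hc ⟨hFr, hA⟩
    have hn1 : M₁ 1 0 0 = n := by rw [hFr.1 1 (Ne.symm h1) (by decide), hn]
    have inner := den_rep (c := 7) (p := store a I J E) (by simp [counts, h3])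
      (fun j M' => Fr M' ∧ M' 3 0 6 = i ∧
        (∀ i' < i, ∀ j < n, i' < n → M' a (fI i' j) (fJ i' j) = fE i' j) ∧
        ∀ j' < j, j' < n → M' a (fI i j') (fJ i j') = fE i j') hn1
      ⟨hFr7 hFr, by rw [Memory.write_eq, if_neg (by simp)]; exact hc, by
        rwa [Memory.write_of_ne h3], by simp⟩ ?_
    · obtain ⟨g1, g2, g3, g4⟩ := inner
      refine ⟨hFr6 g1, fun i' hi' j hj hin => ?_⟩
      rw [Memory.write_of_ne h3]
      rcases Nat.lt_succ_iff_lt_or_eq.1 hi' with hlt | rfl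
      · exact g3 i' hlt j hj hin
      · exact g4 j hj hj
    · rintro j hj M₂ hc7 ⟨g1, g2, g3, g4⟩
      obtain ⟨e1, e2, e3⟩ := hI M₂ i j hi hj g1.1 g1.2.1 g2 hc7
      have hw : (store a I J E).den M₂ = M₂.write a (fI i j) (fJ i j) (fE i j) := by
        rw [den, e1, e2, e3]
      rw [hw]
      have hkeep : ∀ i' < n, ∀ j' < n, (i' ≠ i ∨ j' ≠ j) →
          M₂.write a (fI i j) (fJ i j) (fE i j) a (fI i' j') (fJ i' j') =
            M₂ a (fI i' j') (fJ i' j') := by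
        intro i' hi' j' hj' hne
        rw [Memory.write_eq, if_neg]
        rintro ⟨h4, h5⟩
        obtain ⟨rfl, rfl⟩ := hinj i' hi' j' hj' i hi j hj h4 h5
        simp at hne
      refine ⟨hFr7 ⟨fun b hb hb3 => ?_, fun c h6 h7 => ?_, fun x y hxy => ?_⟩, ?_, ?_, ?_⟩
      · rw [Memory.write_of_ne hb]; exact g1.1 b hb hb3
      · rw [Memory.write_of_ne (Ne.symm h3)]; exact g1.2.1 c h6 h7
      · rw [Memory.write_eq, if_neg]
        · exact g1.2.2 x y hxy
        · rintro ⟨rfl, rfl⟩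
          exact hxy i hi j hj ⟨rfl, rfl⟩
      · rw [Memory.write_eq, if_neg (by simp), Memory.write_of_ne (Ne.symm h3)]; exact g2
      · intro i' hi' j' hj' hin
        rw [Memory.write_of_ne h3, hkeep i' hin j' hj' (Or.inl hi'.ne)]
        exact g3 i' hi' j' hj' hin
      · intro j' hj' hjn
        rw [Memory.write_of_ne h3]
        rcases Nat.lt_succ_iff_lt_or_eq.1 hj' with hlt | rfl
        · rw [hkeep i hi j' hjn (Or.inr hlt.ne)]
          exact g4 j' hlt hjn
        · rw [Memory.write_eq, if_pos ⟨rfl, rfl⟩]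

/-- Array `8` becomes the graph held in row `v` of array `6`, where `v` is counter `2`. -/
def load : Cmd := fill 8 (ctr 6) (ctr 7) (.get 6 (ctr 2) (.get 5 (ctr 6) (ctr 7)))

lemma den_load {M : Memory} (hn : M 1 0 0 = n) {H : SimpleGraph (Fin n)}
    (h : IsRow M (M 3 0 2) H) : IsMat (load.den M) 8 H := by
  have := den_fill (n := n) (a := 8) (I := ctr 6) (J := ctr 7)
    (E := .get 6 (ctr 2) (.get 5 (ctr 6) (ctr 7))) (M := M) hn (by decide) (by decide)
    (fI := fun i _ => i) (fJ := fun _ j => j) (fE := fun i j => M 6 (M 3 0 2) (M 5 i j)) ?_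
    (fun i _ j _ i' _ j' _ h1 h2 => ⟨h1, h2⟩)
  · intro i j
    exact (this.1 i i.2 j j.2).trans (h i j)
  · intro M' i j _ _ hb hc h6 h7
    simp [Expr.eval, h6, h7, hb 6 (by decide) (by decide), hb 5 (by decide) (by decide),
      hc 2 (by decide) (by decide)]

/-- Array `8` is stored as row `w` of array `6`, where `w` is counter `5`. -/
def save : Cmd := fill 6 (ctr 5) (.get 5 (ctr 6) (ctr 7)) (.get 8 (ctr 6) (ctr 7))

/-- The entries of array `5` are different codes for the pairs of numbers below `n`. -/
def IsCode (n : ℕ) (M : Memory) : Prop :=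
  ∀ i < n, ∀ j < n, ∀ i' < n, ∀ j' < n, M 5 i j = M 5 i' j' → i = i' ∧ j = j'

lemma den_save {M : Memory} (hn : M 1 0 0 = n) (hcode : IsCode n M) {H : SimpleGraph (Fin n)}
    (h : IsMat M 8 H) : IsRow (save.den M) (M 3 0 5) H ∧
      ∀ x, x ≠ M 3 0 5 → save.den M 6 x = M 6 x := by
  have := den_fill (n := n) (a := 6) (I := ctr 5) (J := .get 5 (ctr 6) (ctr 7))
    (E := .get 8 (ctr 6) (ctr 7)) (M := M) hn (by decide) (by decide)
    (fI := fun _ _ => M 3 0 5) (fJ := fun i j => M 5 i j) (fE := fun i j => M 8 i j) ?_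
    (fun i hi j hj i' hi' j' hj' _ h2 => hcode i hi j hj i' hi' j' hj' h2)
  · refine ⟨fun i j => ?_, fun x hx => ?_⟩
    · rw [den_of_not_writes (a := 5) save rfl]
      exact (this.1 i i.2 j j.2).trans (h i j)
    · funext y
      exact this.2 x y fun i _ j _ h => hx h.1.symm
  · intro M' i j _ _ hb hc h6 h7
    simp [Expr.eval, h6, h7, hb 8 (by decide) (by decide), hb 5 (by decide) (by decide),
      hc 5 (by decide) (by decide)]

/-- Array `2` is stored as row `v` of array `6`, where `v` is counter `0`. -/
def saveStart : Cmd := fill 6 (ctr 0) (.get 5 (ctr 6) (ctr 7)) (.get 2 (ctr 6) (ctr 7))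

lemma den_saveStart {M : Memory} (hn : M 1 0 0 = n) (hcode : IsCode n M)
    {H : SimpleGraph (Fin n)} (h : IsMat M 2 H) : IsRow (saveStart.den M) (M 3 0 0) H := by
  have := den_fill (n := n) (a := 6) (I := ctr 0) (J := .get 5 (ctr 6) (ctr 7))
    (E := .get 2 (ctr 6) (ctr 7)) (M := M) hn (by decide) (by decide)
    (fI := fun _ _ => M 3 0 0) (fJ := fun i j => M 5 i j) (fE := fun i j => M 2 i j) ?_
    (fun i hi j hj i' hi' j' hj' _ h2 => hcode i hi j hj i' hi' j' hj' h2)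
  · intro i j
    rw [den_of_not_writes (a := 5) saveStart rfl]
    exact (this.1 i i.2 j j.2).trans (h i j)
  · intro M' i j _ _ hb hc h6 h7
    simp [Expr.eval, h6, h7, hb 2 (by decide) (by decide), hb 5 (by decide) (by decide),
      hc 0 (by decide) (by decide)]

/-- Array `8` is stored in array `2`. -/
def output : Cmd := fill 2 (ctr 6) (ctr 7) (.get 8 (ctr 6) (ctr 7))

lemma den_output {M : Memory} (hn : M 1 0 0 = n) {H : SimpleGraph (Fin n)}
    (h : IsMat M 8 H) : IsMat (output.den M) 2 H := by
  have := den_fill (n := n) (a := 2) (I := ctr 6) (J := ctr 7)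
    (E := .get 8 (ctr 6) (ctr 7)) (M := M) hn (by decide) (by decide)
    (fI := fun i _ => i) (fJ := fun _ j => j) (fE := fun i j => M 8 i j) ?_
    (fun i _ j _ i' _ j' _ h1 h2 => ⟨h1, h2⟩)
  · intro i j
    exact (this.1 i i.2 j j.2).trans (h i j)
  · intro M' i j _ _ hb hc h6 h7
    simp [Expr.eval, h6, h7, hb 8 (by decide) (by decide)]

/-- All entries of an array with indices below `n` become zero. -/
def clear (a : ℕ) : Cmd := fill a (ctr 6) (ctr 7) (.lit 0)

lemma den_clear {M : Memory} (hn : M 1 0 0 = n) {a : ℕ} (h1 : a ≠ 1) (h3 : a ≠ 3) (i j : Fin n) :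
    (clear a).den M a i j = 0 := by
  have := den_fill (n := n) (a := a) (I := ctr 6) (J := ctr 7)
    (E := .lit 0) (M := M) hn h1 h3
    (fI := fun i _ => i) (fJ := fun _ j => j) (fE := fun _ _ => 0) ?_
    (fun i _ j _ i' _ j' _ h1 h2 => ⟨h1, h2⟩)
  · exact this.1 i i.2 j j.2
  · intro M' i j _ _ hb hc h6 h7
    simp [Expr.eval, h6, h7]

/-- In array `8`, the edge `qw` is deleted, where `q` and `w` are the counters `4` and `5`. -/
def cutEdge : Cmd :=
  seq (store 8 (ctr 4) (ctr 5) (.lit 0)) (store 8 (ctr 5) (ctr 4) (.lit 0))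

lemma den_cutEdge {M : Memory} {H : SimpleGraph (Fin n)} {q w : Fin n} (h : IsMat M 8 H)
    (hq : M 3 0 4 = q) (hw : M 3 0 5 = w) : IsMat (cutEdge.den M) 8 (cut H q w) := by
  intro i j
  have := h i j
  simp only [cutEdge, den, Expr.eval, Memory.write_of_ne (show 3 ≠ 8 by decide), hq, hw,
    Memory.write_eq, Fin.val_inj, this]
  have hadj := cut_adj (H := H) (q := q) (w := w) (a := i) (b := j)
  split_ifs <;> simp_all

/-- In array `8`, the edge `vp` is added, where `v` and `p` are the counters `2` and `3`. -/
def linkEdge : Cmd :=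
  seq (store 8 (ctr 2) (ctr 3) (.lit 1)) (store 8 (ctr 3) (ctr 2) (.lit 1))

lemma den_linkEdge {M : Memory} {H : SimpleGraph (Fin n)} {v p : Fin n} (h : IsMat M 8 H)
    (hv : M 3 0 2 = v) (hp : M 3 0 3 = p) (hne : v ≠ p) :
    IsMat (linkEdge.den M) 8 (link H v p) := by
  intro i j
  have := h i j
  simp only [linkEdge, den, Expr.eval, Memory.write_of_ne (show 3 ≠ 8 by decide), hv, hp,
    Memory.write_eq, Fin.val_inj, this]
  have hadj := link_adj (H := H) (a := i) (b := j) hne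
  generalize (link H v p).Adj i j = P at hadj ⊢
  split_ifs <;> simp_all

/-- Entry `(0, 0)` of array `12` becomes the degree of `v` in the graph held in array `a`, where
`v` is a counter. -/
def count (a v : ℕ) : Cmd :=
  seq (store 12 (.lit 0) (.lit 0) (.lit 0))
    (rep 6 (guard (.eq (.get a (ctr v) (ctr 6)) (.lit 1))
      (store 12 (.lit 0) (.lit 0) (.succ (.get 12 (.lit 0) (.lit 0))))))

lemma den_count {M : Memory} (hn : M 1 0 0 = n) {a c : ℕ} (h3 : a ≠ 3) (h12 : a ≠ 12) (hc : c ≠ 6)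
    {H : SimpleGraph (Fin n)} (h : IsMat M a H) {v : Fin n} (hv : M 3 0 c = v) :
    (count a c).den M 12 0 0 = dg H v := by
  classical
  have := den_rep (c := 6) (n := n) (p := guard (.eq (.get a (ctr c) (ctr 6)) (.lit 1))
      (store 12 (.lit 0) (.lit 0) (.succ (.get 12 (.lit 0) (.lit 0))))) rfl
    (fun i M' => IsMat M' a H ∧ M' 3 0 c = v ∧
      M' 12 0 0 = (Finset.univ.filter fun j : Fin n => H.Adj v j ∧ j.1 < i).card)
    (M := M.write 12 0 0 0) (by rw [Memory.write_of_ne (by decide), hn]) ?_ ?_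
  · rw [count, den]
    refine (this.2.2).trans ?_
    unfold dg nbrs
    congr 1
    ext j
    simp
  · refine ⟨h.congr ?_, ?_, ?_⟩
    · rw [Memory.write_of_ne h3, Memory.write_of_ne h12]
    · rw [Memory.write_eq, if_neg (by simp [hc]), Memory.write_of_ne (by decide)]; exact hv
    · rw [Memory.write_of_ne (by decide), Memory.write_eq]; simp
  · rintro i hi M' h6 ⟨g1, g2, g3⟩
    have hb : (Test.eq (.get a (ctr c) (ctr 6)) (.lit 1)).eval M' = decide (H.Adj v ⟨i, hi⟩) := by
      simp only [Test.eval, Expr.eval, h6, g2]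
      exact decide_eq_decide.2 (g1.eq_one_iff v ⟨i, hi⟩)
    have hstep : (Finset.univ.filter fun j : Fin n => H.Adj v j ∧ j.1 < i + 1) =
        (Finset.univ.filter fun j : Fin n => H.Adj v j ∧ j.1 < i) ∪
          if H.Adj v ⟨i, hi⟩ then {⟨i, hi⟩} else ∅ := by
      ext j
      by_cases hj : j = ⟨i, hi⟩
      · subst hj; split_ifs with ha <;> simp [ha]
      · have : j.1 ≠ i := fun he => hj (Fin.ext he)
        split_ifs <;> simp [hj] <;> intro <;> omega
    by_cases hadj : H.Adj v ⟨i, hi⟩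
    · rw [den_guard_of_true (by rw [hb]; simpa using hadj)]
      refine ⟨g1.congr ?_, ?_, ?_⟩
      · rw [Memory.write_of_ne h3, den, Memory.write_of_ne h12]
      · rw [Memory.write_eq, if_neg (by simp [hc]), den, Memory.write_of_ne (by decide)]; exact g2
      · rw [hstep, if_pos hadj, Finset.card_union_of_disjoint (by simp), Finset.card_singleton,
          ← g3]
        simp [den, Memory.write, Expr.eval]
    · rw [den_guard_of_false (by rw [hb]; simpa using hadj)]
      refine ⟨g1.congr ?_, ?_, ?_⟩
      · rw [Memory.write_of_ne h3]
      · rw [Memory.write_eq, if_neg (by simp [hc])]; exact g2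
      · rw [hstep, if_neg hadj, Finset.union_empty, ← g3, Memory.write_of_ne (by decide)]

/-- Row `0` of array `r` becomes the set of vertices that can be reached from `v` in the graph held
in array `8`, where `v` is counter `2`. -/
def reach (r : ℕ) : Cmd :=
  seq (clear r) (seq (store r (.lit 0) (ctr 2) (.lit 1))
    (rep 8 (rep 6 (rep 7 (guard (.eq (.get r (.lit 0) (ctr 6)) (.lit 1))
      (guard (.eq (.get 8 (ctr 6) (ctr 7)) (.lit 1)) (store r (.lit 0) (ctr 7) (.lit 1))))))))

-- Only reachable vertices are ever marked, and `k` passes mark everything within distance `k`; `n`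
-- passes suffice because a path has fewer than `n` edges.
open Classical in
lemma den_reach {M : Memory} (hn : M 1 0 0 = n) {r : ℕ} (h1 : r ≠ 1) (h3 : r ≠ 3) (h8 : r ≠ 8)
    {H : SimpleGraph (Fin n)} (h : IsMat M 8 H) {v : Fin n} (hv : M 3 0 2 = v) (j : Fin n) :
    (reach r).den M r 0 j = if H.Reachable v j then 1 else 0 := by
  let near : ℕ → Fin n → Prop := fun k j => ∃ p : H.Walk v j, p.length ≤ k
  let Ok : Memory → Prop := fun M' => M' 1 0 0 = n ∧ IsMat M' 8 H ∧
    ∀ j : Fin n, M' r 0 j = 0 ∨ M' r 0 j = 1 ∧ H.Reachable v j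
  let Near : ℕ → Memory → Prop := fun k M' => ∀ j : Fin n, near k j → M' r 0 j = 1
  have hOk : ∀ {M' : Memory} {c x : ℕ}, Ok M' → Ok (M'.write 3 0 c x) := by
    rintro M' c x ⟨f1, f2, f3⟩
    refine ⟨?_, f2.congr (Memory.write_of_ne (by decide)), ?_⟩
    · rw [Memory.write_of_ne (by decide), f1]
    · rwa [Memory.write_of_ne h3]
  have hwalk : ∀ {k : ℕ} {j : Fin n}, near (k + 1) j → near k j ∨
      ∃ i, near k i ∧ H.Adj i j := by
    rintro k j ⟨p, hp⟩
    by_cases hpk : p.length ≤ k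
    · exact Or.inl ⟨p, hpk⟩
    have hnil : ¬ p.Nil := by
      rw [← SimpleGraph.Walk.length_eq_zero_iff]; omega
    refine Or.inr ⟨p.penultimate, ⟨p.dropLast, ?_⟩, p.adj_penultimate hnil⟩
    rw [SimpleGraph.Walk.dropLast, SimpleGraph.Walk.take_length]
    omega
  have pass : ∀ (k : ℕ) (M' : Memory), Ok M' → Near k M' →
      Ok ((rep 6 (rep 7 (guard (.eq (.get r (.lit 0) (ctr 6)) (.lit 1))
        (guard (.eq (.get 8 (ctr 6) (ctr 7)) (.lit 1))
          (store r (.lit 0) (ctr 7) (.lit 1)))))).den M') ∧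
      Near (k + 1) ((rep 6 (rep 7 (guard (.eq (.get r (.lit 0) (ctr 6)) (.lit 1))
        (guard (.eq (.get 8 (ctr 6) (ctr 7)) (.lit 1))
          (store r (.lit 0) (ctr 7) (.lit 1)))))).den M') := by
    intro k M' hok hnear
    have main := den_rep (c := 6) (n := n)
      (p := rep 7 (guard (.eq (.get r (.lit 0) (ctr 6)) (.lit 1))
        (guard (.eq (.get 8 (ctr 6) (ctr 7)) (.lit 1)) (store r (.lit 0) (ctr 7) (.lit 1)))))
      (by simp [counts, guard, h3])
      (fun i M₁ => Ok M₁ ∧ Near k M₁ ∧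
        ∀ i' : Fin n, i'.1 < i → near k i' → ∀ j : Fin n, H.Adj i' j → M₁ r 0 j = 1)
      (M := M') hok.1 ⟨hOk hok, ?_, by simp⟩ ?_
    · refine ⟨main.1, fun j hj => ?_⟩
      rcases hwalk hj with hj | ⟨i, hi, hij⟩
      · exact main.2.1 j hj
      · exact main.2.2 i i.2 hi j hij
    · intro j hj
      rw [Memory.write_of_ne h3]; exact hnear j hj
    · rintro i hi M₁ hc ⟨g1, g2, g3⟩
      have inner := den_rep (c := 7) (n := n)
        (p := guard (.eq (.get r (.lit 0) (ctr 6)) (.lit 1))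
          (guard (.eq (.get 8 (ctr 6) (ctr 7)) (.lit 1)) (store r (.lit 0) (ctr 7) (.lit 1))))
        (by simp [counts, guard, h3])
        (fun j M₂ => Ok M₂ ∧ (∀ j : Fin n, M₁ r 0 j = 1 → M₂ r 0 j = 1) ∧ M₂ 3 0 6 = i ∧
          ∀ j' : Fin n, j'.1 < j → near k ⟨i, hi⟩ → H.Adj ⟨i, hi⟩ j' → M₂ r 0 j' = 1)
        (M := M₁) g1.1 ⟨hOk g1, ?_, ?_, by simp⟩ ?_
      · refine ⟨hOk inner.1, fun j hj => ?_, fun i' hi' hni j hj => ?_⟩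
        · rw [Memory.write_of_ne h3]; exact inner.2.1 j (g2 j hj)
        · rw [Memory.write_of_ne h3]
          rcases Nat.lt_succ_iff_lt_or_eq.1 hi' with hlt | heq
          · exact inner.2.1 j (g3 i' hlt hni j hj)
          · have : i' = ⟨i, hi⟩ := Fin.ext heq
            subst this
            exact inner.2.2.2 j j.2 hni hj
      · intro j hj; rwa [Memory.write_of_ne h3]
      · rw [Memory.write_eq, if_neg (by simp)]; exact hc
      · rintro j hj M₂ hc7 ⟨f1, f2, f3, f4⟩
        have hb8 : (Test.eq (.get 8 (ctr 6) (ctr 7)) (.lit 1)).eval M₂ =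
            decide (H.Adj ⟨i, hi⟩ ⟨j, hj⟩) := by
          simp only [Test.eval, Expr.eval, f3, hc7]
          exact decide_eq_decide.2 (f1.2.1.eq_one_iff ⟨i, hi⟩ ⟨j, hj⟩)
        have hbr : (Test.eq (.get r (.lit 0) (ctr 6)) (.lit 1)).eval M₂ =
            decide (M₂ r 0 i = 1) := by
          simp only [Test.eval, Expr.eval, f3]
        by_cases ha : M₂ r 0 i = 1 ∧ H.Adj ⟨i, hi⟩ ⟨j, hj⟩
        · rw [den_guard_of_true (by rw [hbr]; simpa using ha.1),
            den_guard_of_true (by rw [hb8]; simpa using ha.2)]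
          have hw : (store r (.lit 0) (ctr 7) (.lit 1)).den M₂ = M₂.write r 0 j 1 := by
            simp [den, Expr.eval, hc7]
          have hone : ∀ j' : Fin n, M₂ r 0 j' = 1 → M₂.write r 0 j 1 r 0 j' = 1 := by
            intro j' hj'
            rw [Memory.write_eq]; split_ifs <;> simp [hj']
          rw [hw]
          refine ⟨hOk ⟨?_, f1.2.1.congr (Memory.write_of_ne (Ne.symm h8)), fun j' => ?_⟩,
            fun j' hj' => ?_, ?_, fun j' hj' hni hij => ?_⟩
          · rw [Memory.write_of_ne (Ne.symm h1), f1.1]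
          · by_cases hjj : j'.1 = j
            · have : j' = ⟨j, hj⟩ := Fin.ext hjj
              subst this
              refine Or.inr ⟨by simp [Memory.write], ?_⟩
              rcases f1.2.2 ⟨i, hi⟩ with h0 | h0
              · rw [ha.1] at h0; simp at h0
              · exact h0.2.trans ha.2.reachable
            · rw [Memory.write_eq, if_neg (by simp [hjj])]
              exact f1.2.2 j'
          · rw [Memory.write_of_ne h3]; exact hone j' (f2 j' hj')
          · rw [Memory.write_eq, if_neg (by simp), Memory.write_of_ne (Ne.symm h3)]; exact f3
          · rw [Memory.write_of_ne h3]
            rcases Nat.lt_succ_iff_lt_or_eq.1 hj' with hlt | heq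
            · exact hone j' (f4 j' hlt hni hij)
            · simp [Memory.write, heq]
        · have hden : (guard (.eq (.get r (.lit 0) (ctr 6)) (.lit 1))
              (guard (.eq (.get 8 (ctr 6) (ctr 7)) (.lit 1))
                (store r (.lit 0) (ctr 7) (.lit 1)))).den M₂ = M₂ := by
            by_cases ha1 : M₂ r 0 i = 1
            · rw [den_guard_of_true (by rw [hbr]; simpa using ha1)]
              exact den_guard_of_false (by rw [hb8]; simpa using fun h2 => ha ⟨ha1, h2⟩)
            · exact den_guard_of_false (by rw [hbr]; simpa using ha1)
          rw [hden]
          refine ⟨hOk f1, fun j' hj' => ?_, ?_, fun j' hj' hni hij => ?_⟩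
          · rw [Memory.write_of_ne h3]; exact f2 j' hj'
          · rw [Memory.write_eq, if_neg (by simp)]; exact f3
          · rw [Memory.write_of_ne h3]
            rcases Nat.lt_succ_iff_lt_or_eq.1 hj' with hlt | heq
            · exact f4 j' hlt hni hij
            · have hjj : j' = ⟨j, hj⟩ := Fin.ext heq
              exact absurd ⟨f2 ⟨i, hi⟩ (g2 _ hni), hjj ▸ hij⟩ ha
  have hcl := den_clear hn h1 h3
  have hfr : ∀ b, b ≠ r → b ≠ 3 → (clear r).den M b = M b := fun b hb hb3 =>
    den_of_not_writes _ (by simp [clear, fill, writes, hb, hb3]) M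
  have hc2 : (clear r).den M 3 0 2 = v := by
    rw [den_of_not_counts (c := 2) _ (by simp [clear, fill, counts, h3]) M, hv]
  have hw : (store r (.lit 0) (ctr 2) (.lit 1)).den ((clear r).den M) =
      ((clear r).den M).write r 0 v 1 := by
    simp [den, Expr.eval, hc2]
  have main := den_rep (c := 8) (n := n)
    (p := rep 6 (rep 7 (guard (.eq (.get r (.lit 0) (ctr 6)) (.lit 1))
      (guard (.eq (.get 8 (ctr 6) (ctr 7)) (.lit 1)) (store r (.lit 0) (ctr 7) (.lit 1))))))
    (by simp [counts, guard, h3]) (fun k M' => Ok M' ∧ Near k M')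
    (M := ((clear r).den M).write r 0 v 1) ?_ ⟨hOk ⟨?_, ?_, ?_⟩, ?_⟩ ?_
  · rw [reach, den, den, hw]
    by_cases hr : H.Reachable v j
    · rw [if_pos hr]
      obtain ⟨p, hp⟩ := hr.exists_isPath
      have := hp.length_lt
      rw [Fintype.card_fin] at this
      exact main.2 j ⟨p, this.le⟩
    · rw [if_neg hr]
      rcases main.1.2.2 j with h0 | h0
      · exact h0
      · exact absurd h0.2 hr
  · rw [Memory.write_of_ne (Ne.symm h1), hfr 1 (Ne.symm h1) (by decide), hn]
  · rw [Memory.write_of_ne (Ne.symm h1), hfr 1 (Ne.symm h1) (by decide), hn]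
  · exact h.congr (by rw [Memory.write_of_ne (Ne.symm h8), hfr 8 (Ne.symm h8) (by decide)])
  · intro j'
    rw [Memory.write_eq]
    have : n ≠ 0 := fun h0 => by subst h0; exact v.elim0
    have h0 := hcl ⟨0, by omega⟩ j'
    by_cases hj : j' = v
    · subst hj; exact Or.inr ⟨by simp, SimpleGraph.Reachable.refl _⟩
    · exact Or.inl (by rw [if_neg (by simp [Fin.val_inj, hj])]; exact h0)
  · rintro j' ⟨p, hp⟩
    have : v = j' := SimpleGraph.Walk.eq_of_length_eq_zero (p := p) (by omega)
    subst this
    rw [Memory.write_of_ne h3, Memory.write_eq, if_pos ⟨rfl, rfl⟩]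
  · rintro k hk M' - ⟨g1, g2⟩
    obtain ⟨g3, g4⟩ := pass k M' g1 g2
    exact ⟨hOk g3, fun j' hj' => by rw [Memory.write_of_ne h3]; exact g4 j' hj'⟩

end Cmd

end ArrayMachine

/-! ### Rounds of the search -/

namespace AugSearch

variable {V : Type*} [Fintype V] {G : SimpleGraph V} {A : Set V} {F : SimpleGraph V} {v₀ : V}
  {D : Finset V} {S : V → SimpleGraph V}

open Classical in
/-- The result `F'` of a search: one more edge at `v₀`, the same degrees at the other vertices of
`A`, and no new isolated vertices outside `A`. -/
structure Gained (G : SimpleGraph V) (A : Set V) (F : SimpleGraph V) (v₀ : V)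
    (F' : SimpleGraph V) : Prop where
  le : F' ≤ G
  forest : IsLinForest F'
  deg_mem : ∀ u ∈ A, dg F' u = dg F u + if u = v₀ then 1 else 0
  deg_notMem : ∀ u ∉ A, 1 ≤ dg F u → 1 ≤ dg F' u

/-- The states between two rounds of the search. -/
structure Round (G : SimpleGraph V) (A : Set V) (F : SimpleGraph V) (v₀ : V) (D : Finset V)
    (S : V → SimpleGraph V) : Prop where
  state : State G A F v₀ D S
  stage : ∃ E r, Stage G A F D S E r ∧
    ∀ v ∈ E, ∀ p q w, Move G A D S v p q w → ¬ (S v).Reachable v p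

lemma Round.init (hF : Start G A F v₀) (hS : S v₀ = F) : Round G A F v₀ {v₀} S :=
  ⟨State.init hF hS, ∅, v₀, Stage.init hS, by simp⟩

lemma State.gain (hF : Start G A F v₀) (h : State G A F v₀ D S) {v p : V} (hg : Gain G D S v p) :
    Gained G A F v₀ (link (S v) v p) := by
  have hpA : p ∉ A := (hF.bip hg.adj).1 (h.sub v hg.mem)
  refine ⟨fun a b hab => ?_, ?_, fun u hu => ?_, fun u hu h1 => ?_⟩
  · rw [link_adj hg.adj.ne] at hab
    rcases hab with hab | ⟨rfl, rfl⟩ | ⟨rfl, rfl⟩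
    · exact h.le v hg.mem hab
    · exact hg.adj
    · exact hg.adj.symm
  · exact (h.forest v hg.mem).link hg.sep (h.dg_self_le hF hg.mem) hg.deg
  · have h2 := h.deg_mem v hg.mem u hu
    have hup : u ≠ p := fun he => hpA (he ▸ hu)
    rw [dg_link hg.adj.ne hg.notAdj, ← h2]
    by_cases huv : u = v <;> simp [hup, huv]
  · rw [dg_link hg.adj.ne hg.notAdj]
    exact (h.deg_notMem v hg.mem u hu h1).trans (Nat.le_add_right _ _)

section step

variable {v p q w : V}

-- Old vertices acquire no new moves: their graphs are unchanged and the demand that the target be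
-- new only gets stronger.
open Classical in
lemma Move.of_insert {K : SimpleGraph V} {v' p' q' w' : V} (hw : w ∉ D) (hv : v' ∈ D)
    (hm : Move G A (insert w D) (Function.update S w K) v' p' q' w') :
    Move G A D S v' p' q' w' ∧ Function.update S w K v' = S v' := by
  have hold : Function.update S w K v' = S v' :=
    Function.update_of_ne (fun he => hw (by rwa [he] at hv)) _ _
  obtain ⟨-, h2, h3, h4, h5, h6, h7, h8⟩ := hm
  rw [hold] at h3 h4 h7 h8
  exact ⟨⟨hv, h2, h3, h4, h5, fun h => h6 (Finset.mem_insert_of_mem h), h7, h8⟩, hold⟩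

-- Vertices of `E` have no moves inside their components left, so `v` belongs to the current stage,
-- which continues.
open Classical in
lemma Round.step_of_reachable (hF : Start G A F v₀) (h : Round G A F v₀ D S)
    (hno : ∀ v p, ¬ Gain G D S v p) (hm : Move G A D S v p q w) (hr : (S v).Reachable v p) :
    Round G A F v₀ (insert w D) (Function.update S w (link (cut (S v) q w) v p)) := by
  obtain ⟨E, r, hs, hE⟩ := h.stage
  refine ⟨h.state.step hF hno hm, E, r, hs.step hm (fun hv => hE v hv p q w hm hr) hr, ?_⟩
  intro v' hv' p' q' w' hm'
  obtain ⟨h1, h2⟩ := hm'.of_insert hm.new (hs.sub hv')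
  rw [h2]
  exact hE v' hv' p' q' w' h1

-- With no inside move left, the stage is saturated. Its count is what the next stage needs, and all
-- of `D` becomes old.
open Classical in
lemma Round.step (hF : Start G A F v₀) (h : Round G A F v₀ D S)
    (hno : ∀ v p, ¬ Gain G D S v p)
    (hint : ∀ v p q w, Move G A D S v p q w → ¬ (S v).Reachable v p)
    (hm : Move G A D S v p q w) :
    Round G A F v₀ (insert w D) (Function.update S w (link (cut (S v) q w) v p)) := by
  obtain ⟨E, r, hs, -⟩ := h.stage
  obtain ⟨h1, h2⟩ := hs.saturated hF h.state hint
  refine ⟨h.state.step hF hno hm, D, w, Stage.next hF h.state hno hm h1 h2, ?_⟩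
  intro v' hv' p' q' w' hm'
  obtain ⟨h1, h2⟩ := hm'.of_insert hm.new hv'
  rw [h2]
  exact hint v' p' q' w' h1

end step

lemma Round.exists_of_degree_four (hF : Start G A F v₀) (h : Round G A F v₀ D S)
    (h4 : ∀ v ∈ A, dg G v = 4) (h3 : ∀ v ∉ A, dg G v = 3) (hno : ∀ v p, ¬ Gain G D S v p) :
    ∃ v p q w, Move G A D S v p q w := by
  by_cases hint : ∀ v p q w, Move G A D S v p q w → ¬ (S v).Reachable v p
  · obtain ⟨E, r, hs, -⟩ := h.stage
    obtain ⟨h1, h2⟩ := hs.saturated hF h.state hint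
    exact h.state.exists_of_degree_four hF h4 h3 h1 h2 hno
  · push Not at hint
    obtain ⟨v, p, q, w, hm, -⟩ := hint
    exact ⟨v, p, q, w, hm⟩

end AugSearch

/-! ### The search as a program -/

namespace ArrayMachine

namespace Cmd

open AugSearch

variable {n : ℕ} {G F : SimpleGraph (Fin n)} {A : Set (Fin n)} {v₀ : Fin n} {D : Finset (Fin n)}
  {S : Fin n → SimpleGraph (Fin n)} {M M' : Memory}

/-- The tables that are not changed any more: the graph, its degrees and the codes of pairs. -/
structure Static (G : SimpleGraph (Fin n)) (M : Memory) : Prop where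
  size : M 1 0 0 = n
  adj : IsMat M 0 G
  deg : ∀ v : Fin n, M 10 0 v = dg G v
  code : IsCode n M

open Classical in
/-- The memory represents a set `D` of reached vertices and their graphs `S`. -/
structure Rep (G F : SimpleGraph (Fin n)) (D : Finset (Fin n)) (S : Fin n → SimpleGraph (Fin n))
    (M : Memory) : Prop where
  static : Static G M
  out : IsMat M 2 F
  flag : ∀ v : Fin n, M 7 0 v = if v ∈ D then 1 else 0
  row : ∀ v ∈ D, IsRow M v (S v)

/-- A round of the search has not made progress so far. -/
structure Ready (G F : SimpleGraph (Fin n)) (v₀ : Fin n) (D : Finset (Fin n))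
    (S : Fin n → SimpleGraph (Fin n)) (M : Memory) : Prop where
  rep : Rep G F D S M
  root : M 3 0 0 = v₀
  unfinished : M 13 0 0 = 0
  idle : M 14 0 0 = 0

/-- A round of the search has made progress. -/
structure Progress (G : SimpleGraph (Fin n)) (A : Set (Fin n)) (F : SimpleGraph (Fin n))
    (v₀ : Fin n) (D : Finset (Fin n)) (M : Memory) : Prop where
  static : Static G M
  root : M 3 0 0 = v₀
  moved : M 14 0 0 = 1
  result : (M 13 0 0 = 1 ∧ ∃ F', Gained G A F v₀ F' ∧ IsMat M 2 F') ∨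
    (M 13 0 0 = 0 ∧ ∃ D' S', D'.card = D.card + 1 ∧ Rep G F D' S' M ∧ Round G A F v₀ D' S')

lemma Static.congr (h : Static G M) (h0 : M' 0 = M 0) (h1 : M' 1 = M 1) (h5 : M' 5 = M 5)
    (h10 : M' 10 = M 10) : Static G M' where
  size := by rw [h1]; exact h.size
  adj := h.adj.congr h0
  deg := by rw [h10]; exact h.deg
  code := by unfold IsCode; rw [h5]; exact h.code

lemma Static.den (h : Static G M) (p : Cmd)
    (hp : [0, 1, 5, 10].all (fun b => !p.writes b) = true) : Static G (p.den M) := by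
  simp only [List.all_cons, List.all_nil, Bool.and_true, Bool.and_eq_true,
    Bool.not_eq_true'] at hp
  obtain ⟨h0, h1, h5, h10⟩ := hp
  exact h.congr (den_of_not_writes p h0 M) (den_of_not_writes p h1 M) (den_of_not_writes p h5 M)
    (den_of_not_writes p h10 M)

lemma Static.tick (h : Static G M) (c i : ℕ) : Static G (M.write 3 0 c i) :=
  h.congr (Memory.write_of_ne (by decide)) (Memory.write_of_ne (by decide))
    (Memory.write_of_ne (by decide)) (Memory.write_of_ne (by decide))

lemma Rep.congr (h : Rep G F D S M) (h' : Static G M') (h2 : M' 2 = M 2) (h5 : M' 5 = M 5)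
    (h6 : M' 6 = M 6) (h7 : M' 7 = M 7) : Rep G F D S M' where
  static := h'
  out := h.out.congr h2
  flag := by rw [h7]; exact h.flag
  row := fun v hv => (h.row v hv).congr h5 (by rw [h6])

lemma Rep.den (h : Rep G F D S M) (p : Cmd)
    (hp : [0, 1, 5, 10].all (fun b => !p.writes b) = true)
    (hp' : [2, 5, 6, 7].all (fun b => !p.writes b) = true) : Rep G F D S (p.den M) := by
  simp only [List.all_cons, List.all_nil, Bool.and_true, Bool.and_eq_true,
    Bool.not_eq_true'] at hp'
  obtain ⟨h2, h5, h6, h7⟩ := hp'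
  exact h.congr (h.static.den p hp) (den_of_not_writes p h2 M) (den_of_not_writes p h5 M)
    (den_of_not_writes p h6 M) (den_of_not_writes p h7 M)

lemma Rep.tick (h : Rep G F D S M) (c i : ℕ) : Rep G F D S (M.write 3 0 c i) :=
  h.congr (h.static.tick c i) (Memory.write_of_ne (by decide)) (Memory.write_of_ne (by decide))
    (Memory.write_of_ne (by decide)) (Memory.write_of_ne (by decide))

lemma Ready.den (h : Ready G F v₀ D S M) (p : Cmd)
    (hp : [0, 1, 5, 10].all (fun b => !p.writes b) = true)
    (hp' : [2, 5, 6, 7].all (fun b => !p.writes b) = true)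
    (hp'' : [13, 14].all (fun b => !p.writes b) = true) (h0 : p.counts 0 = false) :
    Ready G F v₀ D S (p.den M) := by
  simp only [List.all_cons, List.all_nil, Bool.and_true, Bool.and_eq_true,
    Bool.not_eq_true'] at hp''
  refine ⟨h.rep.den p hp hp', ?_, ?_, ?_⟩
  · rw [den_of_not_counts p h0]; exact h.root
  · rw [den_of_not_writes p hp''.1]; exact h.unfinished
  · rw [den_of_not_writes p hp''.2]; exact h.idle

lemma Ready.tick (h : Ready G F v₀ D S M) {c : ℕ} (hc : c ≠ 0) (i : ℕ) :
    Ready G F v₀ D S (M.write 3 0 c i) := by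
  refine ⟨h.rep.tick c i, ?_, ?_, ?_⟩
  · rw [Memory.write_eq, if_neg (by simp [hc.symm])]; exact h.root
  · rw [Memory.write_of_ne (by decide)]; exact h.unfinished
  · rw [Memory.write_of_ne (by decide)]; exact h.idle

lemma Progress.tick (h : Progress G A F v₀ D M) {c : ℕ} (hc : c ≠ 0) (i : ℕ) :
    Progress G A F v₀ D (M.write 3 0 c i) := by
  refine ⟨h.static.tick c i, ?_, ?_, ?_⟩
  · rw [Memory.write_eq, if_neg (by simp [hc.symm])]; exact h.root
  · rw [Memory.write_of_ne (by decide)]; exact h.moved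
  · rw [Memory.write_of_ne (by decide : (13 : ℕ) ≠ 3)]
    rcases h.result with ⟨h1, F', h2, h3⟩ | ⟨h1, D', S', h2, h3, h4⟩
    · exact Or.inl ⟨h1, F', h2, h3.congr (Memory.write_of_ne (by decide))⟩
    · exact Or.inr ⟨h1, D', S', h2, h3.tick c i, h4⟩

/-! ### Loops that look for a success -/

section loops

variable {R Q : Memory → Prop}

lemma den_rep_of_inv {c : ℕ} {p : Cmd} (hp : p.counts c = false)
    (hw : ∀ M i, Q M → Q (M.write 3 0 c i)) (h : ∀ M, Q M → Q (p.den M)) (hM : Q M) :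
    Q ((rep c p).den M) :=
  den_rep (n := M 1 0 0) hp (fun _ M => Q M) rfl (hw _ _ hM) fun _ _ M _ hM => hw _ _ (h M hM)

/-- A loop that looks for an index with the property `P`. -/
lemma den_rep_search {c : ℕ} {p : Cmd} (hp : p.counts c = false) {P : Fin n → Prop}
    (hR : ∀ M i, R M → R (M.write 3 0 c i)) (hQ : ∀ M i, Q M → Q (M.write 3 0 c i))
    (h : ∀ (i : Fin n) (M : Memory), M 3 0 c = i → R M → (¬ P i ∧ R (p.den M)) ∨ Q (p.den M))
    (hk : ∀ M, Q M → Q (p.den M)) (hn : M 1 0 0 = n) (hM : R M) :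
    ((∀ i, ¬ P i) ∧ R ((rep c p).den M)) ∨ Q ((rep c p).den M) := by
  have := den_rep (n := n) hp
    (fun i M => ((∀ j : Fin n, j.1 < i → ¬ P j) ∧ R M) ∨ Q M) hn
    (Or.inl ⟨by simp, hR _ _ hM⟩) ?_
  · exact this.imp_left fun h1 => ⟨fun i => h1.1 i i.2, h1.2⟩
  · rintro i hi M₁ hc (⟨h1, h2⟩ | h1)
    · rcases h ⟨i, hi⟩ M₁ hc h2 with ⟨h3, h4⟩ | h3
      · refine Or.inl ⟨fun j hj => ?_, hR _ _ h4⟩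
        rcases Nat.lt_succ_iff_lt_or_eq.1 hj with hlt | heq
        · exact h1 j hlt
        · rwa [show j = ⟨i, hi⟩ from Fin.ext heq]
      · exact Or.inr (hQ _ _ h3)
    · exact Or.inr (hQ _ _ (hk _ h1))

/-- `R` means that nothing has been found so far and `Q` that something has. Loops cannot be left
early, so `Q` has to survive the remaining iterations. -/
lemma den_rep_rep_search {c d : ℕ} {p : Cmd} (hc : p.counts c = false) (hd : p.counts d = false)
    (hcd : c ≠ d) {P : Fin n → Fin n → Prop}
    (hR : ∀ M x i, x = c ∨ x = d → R M → R (M.write 3 0 x i))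
    (hQ : ∀ M x i, x = c ∨ x = d → Q M → Q (M.write 3 0 x i))
    (h : ∀ (i j : Fin n) (M : Memory), M 3 0 c = i → M 3 0 d = j → R M →
      (¬ P i j ∧ R (p.den M)) ∨ Q (p.den M))
    (hk : ∀ M, Q M → Q (p.den M)) (hn : ∀ M, R M → M 1 0 0 = n) (hM : R M) :
    ((∀ i j, ¬ P i j) ∧ R ((rep c (rep d p)).den M)) ∨ Q ((rep c (rep d p)).den M) := by
  have hk' : ∀ M, Q M → Q ((rep d p).den M) := fun M =>
    den_rep_of_inv hd (fun M i => hQ M d i (Or.inr rfl)) hk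
  have := den_rep_search (n := n) (c := c) (p := rep d p) (by simp [counts, hc, hcd])
    (P := fun i => ∃ j, P i j) (fun M i => hR M c i (Or.inl rfl))
    (fun M i => hQ M c i (Or.inl rfl)) ?_ hk' (hn M hM) hM
  · exact this.imp_left fun h1 => ⟨fun i j hij => h1.1 i ⟨j, hij⟩, h1.2⟩
  · intro i M₁ hi h1
    have := den_rep_search (n := n) (c := d) (p := p) hd (R := fun M : Memory => R M ∧ M 3 0 c = i)
      (P := fun j => P i j) ?_ (fun M i => hQ M d i (Or.inr rfl)) ?_ hk (hn M₁ h1) ⟨h1, hi⟩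
    · exact this.imp_left fun h1 => ⟨fun ⟨j, hij⟩ => h1.1 j hij, h1.2.1⟩
    · rintro M j ⟨h2, h3⟩
      refine ⟨hR _ _ _ (Or.inr rfl) h2, ?_⟩
      rwa [Memory.write_eq, if_neg (by simp [hcd])]
    · rintro j M hj ⟨h2, h3⟩
      refine (h i j M h3 hj h2).imp_left fun h4 => ⟨h4.1, h4.2, ?_⟩
      rw [den_of_not_counts p hc, h3]

lemma den_guard {b : Test} {p : Cmd} {X : Prop} (h : b.eval M = true ↔ X) (hf : ¬ X → R M)
    (ht : X → R (p.den M)) : R ((guard b p).den M) := by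
  by_cases hX : X
  · rw [den_guard_of_true (h.2 hX)]; exact ht hX
  · rw [den_guard_of_false (by simpa using fun hb => hX (h.1 hb))]; exact hf hX

end loops

lemma eval_eq {e f : Expr} : (Test.eq e f).eval M = true ↔ e.eval M = f.eval M := by
  simp [Test.eval]

lemma eval_lt {e f : Expr} : (Test.lt e f).eval M = true ↔ e.eval M < f.eval M := by
  simp [Test.eval]

/-- Row `0` of array `9` becomes the set of vertices that can be reached from `v`, and entry
`(0, 0)` of array `12` the degree of `p`, in the graph held in array `8`. -/
def probe : Cmd := seq (reach 9) (count 8 3)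

lemma den_probe (hn : M 1 0 0 = n) {H : SimpleGraph (Fin n)} {v p : Fin n} (h : IsMat M 8 H)
    (hv : M 3 0 2 = v) (hp : M 3 0 3 = p) :
    (probe.den M 9 0 p = 0 ↔ ¬ H.Reachable v p) ∧ probe.den M 12 0 0 = dg H p := by
  have h1 := den_reach hn (r := 9) (by decide) (by decide) (by decide) h hv p
  constructor
  · rw [probe, den, den_of_not_writes (a := 9) (count 8 3) rfl, h1]
    split_ifs with h2 <;> simp [h2]
  · rw [probe, den]
    refine den_count (c := 3) ?_ (by decide) (by decide) (by decide) (h.congr ?_) ?_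
    · rw [den_of_not_writes (a := 1) (reach 9) rfl, hn]
    · exact den_of_not_writes (a := 8) (reach 9) rfl M
    · rw [den_of_not_counts (c := 3) (reach 9) rfl, hp]

/-- Unless the round has made progress, the graph `S v` is loaded and `k` is executed, for `v`
in `D` and `vp` an edge outside `S v`. -/
def pick (k : Cmd) : Cmd :=
  guard (.eq (.get 14 (.lit 0) (.lit 0)) (.lit 0)) (guard (.eq (.get 7 (.lit 0) (ctr 2)) (.lit 1))
    (guard (.eq (.get 0 (ctr 2) (ctr 3)) (.lit 1))
      (guard (.eq (.get 6 (ctr 2) (.get 5 (ctr 2) (ctr 3))) (.lit 0)) (seq load k))))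

lemma den_pick_of_ne {k : Cmd} (h : M 14 0 0 ≠ 0) : (pick k).den M = M :=
  den_guard_of_false (by simp [Test.eval, Expr.eval, h])

/-- Membership of `v` in `D` is tested before row `v` is consulted, because `Rep` gives a meaning
only to the rows of reached vertices. -/
lemma den_pick {k : Cmd} {R : Memory → Prop} (h : Ready G F v₀ D S M) {v p : Fin n}
    (hv : M 3 0 2 = v) (hp : M 3 0 3 = p)
    (hf : ¬ (v ∈ D ∧ G.Adj v p ∧ ¬ (S v).Adj v p) → R M)
    (ht : v ∈ D → G.Adj v p → ¬ (S v).Adj v p → IsMat (load.den M) 8 (S v) →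
      Ready G F v₀ D S (load.den M) → R (k.den (load.den M))) : R ((pick k).den M) := by
  have hflag := h.rep.flag v
  refine den_guard (X := True) (eval_eq.trans (by simp [Expr.eval, h.idle])) (by simp) fun _ => ?_
  refine den_guard (X := v ∈ D) (eval_eq.trans ?_) (by tauto) fun h1 => ?_
  · simp [Expr.eval, hv, hflag]
  refine den_guard (X := G.Adj v p) (eval_eq.trans ?_) (by tauto) fun h2 => ?_
  · simp only [Expr.eval, hv, hp]
    exact h.rep.static.adj.eq_one_iff v p
  refine den_guard (X := ¬ (S v).Adj v p) (eval_eq.trans ?_) (by tauto) fun h3 => ?_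
  · simp only [Expr.eval, hv, hp]
    exact (h.rep.row v h1).eq_zero_iff v p
  exact ht h1 h2 h3 (den_load h.rep.static.size (by rw [hv]; exact h.rep.row v h1))
    (h.den load rfl rfl rfl rfl)

/-- Array `8` is changed into the result of the search. -/
def commitGain : Cmd :=
  seq linkEdge (seq output (seq (store 13 (.lit 0) (.lit 0) (.lit 1))
    (store 14 (.lit 0) (.lit 0) (.lit 1))))

/-- If `v` and `p` are a gain, then it is made. -/
def tryGain : Cmd :=
  pick (seq probe (guard (.eq (.get 9 (.lit 0) (ctr 3)) (.lit 0))
    (guard (.lt (.get 12 (.lit 0) (.lit 0)) (.lit 2)) commitGain)))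

lemma den_tryGain (hF : Start G A F v₀) (h : Ready G F v₀ D S M) (hs : State G A F v₀ D S)
    {v p : Fin n} (hv : M 3 0 2 = v) (hp : M 3 0 3 = p) :
    (¬ Gain G D S v p ∧ Ready G F v₀ D S (tryGain.den M)) ∨
      Progress G A F v₀ D (tryGain.den M) := by
  let R : Memory → Prop := fun M' => (¬ Gain G D S v p ∧ Ready G F v₀ D S M') ∨
      Progress G A F v₀ D M'
  change R _
  refine den_pick h hv hp (fun h1 => Or.inl ⟨fun hg => h1 ⟨hg.mem, hg.adj, hg.notAdj⟩, h⟩) ?_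
  intro h1 h2 h3 h8 hr
  have hv1 : load.den M 3 0 2 = v := by rw [den_of_not_counts (c := 2) load rfl, hv]
  have hp1 : load.den M 3 0 3 = p := by rw [den_of_not_counts (c := 3) load rfl, hp]
  generalize load.den M = M₁ at h8 hr hv1 hp1 ⊢
  obtain ⟨h9, h12⟩ := den_probe hr.rep.static.size h8 hv1 hp1
  have hr2 := hr.den probe rfl rfl rfl rfl
  have hv2 : probe.den M₁ 3 0 2 = v := by rw [den_of_not_counts (c := 2) probe rfl, hv1]
  have hp2 : probe.den M₁ 3 0 3 = p := by rw [den_of_not_counts (c := 3) probe rfl, hp1]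
  have h82 := h8.congr (den_of_not_writes (a := 8) probe rfl M₁)
  rw [den]
  generalize probe.den M₁ = M₂ at h9 h12 hr2 hv2 hp2 h82 ⊢
  refine den_guard (X := ¬ (S v).Reachable v p) (eval_eq.trans ?_)
    (fun h4 => Or.inl ⟨fun hg => h4 hg.sep, hr2⟩) fun h4 => ?_
  · simpa only [Expr.eval, hp2] using h9
  refine den_guard (X := dg (S v) p ≤ 1) (eval_lt.trans ?_)
    (fun h5 => Or.inl ⟨fun hg => h5 hg.deg, hr2⟩) fun h5 => ?_
  · simp only [Expr.eval, h12]; omega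
  have hg : Gain G D S v p := ⟨h1, h2, h3, h4, h5⟩
  have h83 := den_linkEdge h82 hv2 hp2 h2.ne
  have hs3 := hr2.rep.static.den linkEdge rfl
  have h0 : linkEdge.den M₂ 3 0 0 = v₀ := by
    rw [den_of_not_counts (c := 0) linkEdge rfl, hr2.root]
  have h2' := den_output hs3.size h83
  rw [commitGain, den, den]
  refine Or.inr ⟨(hs3.den output rfl).den _ rfl, ?_, ?_, Or.inl ⟨?_, _, hs.gain hF hg, ?_⟩⟩
  · rw [den_of_not_counts (c := 0) _ rfl, den_of_not_counts (c := 0) output rfl, h0]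
  · simp [den, Memory.write, Expr.eval]
  · simp [den, Memory.write, Expr.eval]
  · exact h2'.congr (den_of_not_writes (a := 2) _ rfl _)

/-- The new vertex `w` is recorded together with its graph. -/
def commitMove : Cmd :=
  seq linkEdge (seq (store 7 (.lit 0) (ctr 5) (.lit 1)) (seq save
    (store 14 (.lit 0) (.lit 0) (.lit 1))))

/-- If `v`, `p`, `q` and `w` are a move, then it is made; if `k` is not zero, then `p` has to be
in the component of `v`. -/
def tryMove (k : ℕ) : Cmd :=
  pick (guard (.eq (.get 6 (ctr 2) (.get 5 (ctr 4) (ctr 5))) (.lit 1))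
    (guard (.eq (.get 7 (.lit 0) (ctr 5)) (.lit 0))
      (guard (.eq (.get 10 (.lit 0) (ctr 5)) (.get 10 (.lit 0) (ctr 0)))
        (seq (seq (reach 11) cutEdge) (seq probe
          (guard (.eq (.get 9 (.lit 0) (ctr 3)) (.lit 0))
            (guard (.lt (.get 12 (.lit 0) (.lit 0)) (.lit 2))
              (guard (.lt (.lit k) (.succ (.get 11 (.lit 0) (ctr 3)))) commitMove))))))))

open Classical in
lemma den_commitMove (h : Ready G F v₀ D S M) {v p w : Fin n} {H : SimpleGraph (Fin n)}
    (hv : M 3 0 2 = v) (hp : M 3 0 3 = p) (hw : M 3 0 5 = w) (hne : v ≠ p) (hwD : w ∉ D)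
    (h8 : IsMat M 8 H) :
    Rep G F (insert w D) (Function.update S w (link H v p)) (commitMove.den M) ∧
      commitMove.den M 3 0 0 = v₀ ∧ commitMove.den M 13 0 0 = 0 ∧
      commitMove.den M 14 0 0 = 1 := by
  have h81 := den_linkEdge h8 hv hp hne
  have hr1 := h.den linkEdge rfl rfl rfl rfl
  have hw1 : linkEdge.den M 3 0 5 = w := by rw [den_of_not_counts (c := 5) linkEdge rfl, hw]
  rw [commitMove, den]
  generalize linkEdge.den M = M₁ at h81 hr1 hw1 ⊢
  rw [den, show (store 7 (.lit 0) (ctr 5) (.lit 1)).den M₁ = M₁.write 7 0 w 1 by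
    simp [den, Expr.eval, hw1]]
  have hs2 : Static G (M₁.write 7 0 w 1) := hr1.rep.static.congr
    (Memory.write_of_ne (by decide)) (Memory.write_of_ne (by decide))
    (Memory.write_of_ne (by decide)) (Memory.write_of_ne (by decide))
  have hw2 : M₁.write 7 0 w 1 3 0 5 = w := by rw [Memory.write_of_ne (by decide), hw1]
  have h82 : IsMat (M₁.write 7 0 w 1) 8 (link H v p) := h81.congr (Memory.write_of_ne (by decide))
  obtain ⟨hrow, hrows⟩ := den_save hs2.size hs2.code h82
  rw [hw2] at hrow hrows
  have h6 : ∀ M : Memory, (seq save (store 14 (.lit 0) (.lit 0) (.lit 1))).den M 6 =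
      save.den M 6 := fun M => by
    rw [den, den_of_not_writes (a := 6) (store 14 (.lit 0) (.lit 0) (.lit 1)) rfl]
  have h5 : ∀ M : Memory, (seq save (store 14 (.lit 0) (.lit 0) (.lit 1))).den M 5 = M 5 :=
    fun M => den_of_not_writes (a := 5) _ rfl M
  refine ⟨⟨hs2.den _ rfl, ?_, ?_, ?_⟩, ?_, ?_, ?_⟩
  · refine hr1.rep.out.congr ?_
    rw [den_of_not_writes (a := 2) _ rfl, Memory.write_of_ne (by decide)]
  · intro u
    rw [den_of_not_writes (a := 7) _ rfl, Memory.write_eq, hr1.rep.flag u]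
    by_cases huw : u = w
    · simp [huw]
    · simp [huw, Fin.val_inj]
  · intro u hu
    by_cases huw : u = w
    · subst huw
      rw [Function.update_self]
      refine hrow.congr ?_ (by rw [h6])
      rw [h5, den_of_not_writes (a := 5) save rfl]
    · rw [Function.update_of_ne huw]
      refine (hr1.rep.row u ((Finset.mem_insert.1 hu).resolve_left huw)).congr ?_ ?_
      · rw [h5, Memory.write_of_ne (by decide)]
      · rw [h6, hrows u (by simpa [Fin.val_inj] using huw), Memory.write_of_ne (by decide)]
  · rw [den_of_not_counts (c := 0) _ rfl, Memory.write_of_ne (by decide), hr1.root]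
  · rw [den_of_not_writes (a := 13) _ rfl, Memory.write_of_ne (by decide), hr1.unfinished]
  · simp [den, Memory.write, Expr.eval]

open Classical in
lemma den_tryMove {k : ℕ} (hk : k ≤ 1) (hA : ∀ u, u ∈ A ↔ dg G u = dg G v₀)
    (hnext : ∀ v p q w, Move G A D S v p q w → (k ≠ 0 → (S v).Reachable v p) →
      Round G A F v₀ (insert w D) (Function.update S w (link (cut (S v) q w) v p)))
    (h : Ready G F v₀ D S M) {v p q w : Fin n} (hv : M 3 0 2 = v) (hp : M 3 0 3 = p)
    (hq : M 3 0 4 = q) (hw : M 3 0 5 = w) :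
    (¬ (Move G A D S v p q w ∧ (k ≠ 0 → (S v).Reachable v p)) ∧
      Ready G F v₀ D S ((tryMove k).den M)) ∨ Progress G A F v₀ D ((tryMove k).den M) := by
  let R : Memory → Prop := fun M' =>
    (¬ (Move G A D S v p q w ∧ (k ≠ 0 → (S v).Reachable v p)) ∧ Ready G F v₀ D S M') ∨
      Progress G A F v₀ D M'
  change R _
  refine den_pick h hv hp
    (fun h1 => Or.inl ⟨fun hm => h1 ⟨hm.1.mem, hm.1.adj, hm.1.notAdj⟩, h⟩) ?_
  intro h1 h2 h3 h8 hr
  have hv1 : load.den M 3 0 2 = v := by rw [den_of_not_counts (c := 2) load rfl, hv]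
  have hp1 : load.den M 3 0 3 = p := by rw [den_of_not_counts (c := 3) load rfl, hp]
  have hq1 : load.den M 3 0 4 = q := by rw [den_of_not_counts (c := 4) load rfl, hq]
  have hw1 : load.den M 3 0 5 = w := by rw [den_of_not_counts (c := 5) load rfl, hw]
  generalize load.den M = M₁ at h8 hr hv1 hp1 hq1 hw1 ⊢
  refine den_guard (X := (S v).Adj q w) (eval_eq.trans ?_)
    (fun h4 => Or.inl ⟨fun hm => h4 hm.1.edge, hr⟩) fun h4 => ?_
  · simp only [Expr.eval, hv1, hq1, hw1]
    exact (hr.rep.row v h1).eq_one_iff q w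
  refine den_guard (X := w ∉ D) (eval_eq.trans ?_)
    (fun h5 => Or.inl ⟨fun hm => h5 hm.1.new, hr⟩) fun h5 => ?_
  · simp [Expr.eval, hw1, hr.rep.flag w]
  refine den_guard (X := w ∈ A) (eval_eq.trans ?_)
    (fun h6 => Or.inl ⟨fun hm => h6 hm.1.side, hr⟩) fun h6 => ?_
  · simp only [Expr.eval, hw1, hr.root, hr.rep.static.deg, hA]
  -- Reachability in `S v` is recorded before the edge is cut, since a move inside a component
  -- refers to the uncut graph.
  have h11 := den_reach hr.rep.static.size (r := 11) (by decide) (by decide) (by decide) h8 hv1 p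
  have hr2 := hr.den (seq (reach 11) cutEdge) rfl rfl rfl rfl
  have hv2 : (seq (reach 11) cutEdge).den M₁ 3 0 2 = v := by
    rw [den_of_not_counts (c := 2) _ rfl, hv1]
  have hp2 : (seq (reach 11) cutEdge).den M₁ 3 0 3 = p := by
    rw [den_of_not_counts (c := 3) _ rfl, hp1]
  have hw2 : (seq (reach 11) cutEdge).den M₁ 3 0 5 = w := by
    rw [den_of_not_counts (c := 5) _ rfl, hw1]
  have h82 : IsMat ((seq (reach 11) cutEdge).den M₁) 8 (cut (S v) q w) := by
    refine den_cutEdge (h8.congr (den_of_not_writes (a := 8) (reach 11) rfl M₁)) ?_ ?_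
    · rw [den_of_not_counts (c := 4) _ rfl, hq1]
    · rw [den_of_not_counts (c := 5) _ rfl, hw1]
  have h112 : (seq (reach 11) cutEdge).den M₁ 11 0 p = if (S v).Reachable v p then 1 else 0 := by
    rw [den, den_of_not_writes (a := 11) cutEdge rfl, h11]
  rw [den]
  generalize (seq (reach 11) cutEdge).den M₁ = M₂ at hr2 hv2 hp2 hw2 h82 h112 ⊢
  obtain ⟨h9, h12⟩ := den_probe hr2.rep.static.size h82 hv2 hp2
  have hr3 := hr2.den probe rfl rfl rfl rfl
  have hv3 : probe.den M₂ 3 0 2 = v := by rw [den_of_not_counts (c := 2) probe rfl, hv2]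
  have hp3 : probe.den M₂ 3 0 3 = p := by rw [den_of_not_counts (c := 3) probe rfl, hp2]
  have hw3 : probe.den M₂ 3 0 5 = w := by rw [den_of_not_counts (c := 5) probe rfl, hw2]
  have h83 := h82.congr (den_of_not_writes (a := 8) probe rfl M₂)
  have h113 : probe.den M₂ 11 0 p = if (S v).Reachable v p then 1 else 0 := by
    rw [den_of_not_writes (a := 11) probe rfl, h112]
  rw [den]
  generalize probe.den M₂ = M₃ at h9 h12 hr3 hv3 hp3 hw3 h83 h113 ⊢
  refine den_guard (X := ¬ (cut (S v) q w).Reachable v p) (eval_eq.trans ?_)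
    (fun h4 => Or.inl ⟨fun hm => h4 hm.1.sep, hr3⟩) fun h7 => ?_
  · simpa only [Expr.eval, hp3] using h9
  refine den_guard (X := dg (cut (S v) q w) p ≤ 1) (eval_lt.trans ?_)
    (fun h5 => Or.inl ⟨fun hm => h5 hm.1.deg, hr3⟩) fun h10 => ?_
  · simp only [Expr.eval, h12]; omega
  -- The mark is 0 or 1, so `k < mark + 1` always holds for `k = 0`, and for `k = 1` only if `p` was
  -- reachable.
  refine den_guard (X := k ≠ 0 → (S v).Reachable v p) (eval_lt.trans ?_)
    (fun h5 => Or.inl ⟨fun hm => h5 hm.2, hr3⟩) fun hkr => ?_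
  · simp only [Expr.eval, hp3, h113]
    split_ifs with h13
    · simp [h13]; omega
    · simp [h13]
  have hm : Move G A D S v p q w := ⟨h1, h2, h3, h4, h6, h5, h7, h10⟩
  obtain ⟨g1, g2, g3, g4⟩ := den_commitMove hr3 hv3 hp3 hw3 h2.ne h5 h83
  exact Or.inr ⟨g1.static, g2, g4, Or.inr ⟨g3, _, _, Finset.card_insert_of_notMem h5, g1,
    hnext v p q w hm hkr⟩⟩

end Cmd

end ArrayMachine

/-! ### The program -/

namespace ArrayMachine

namespace Cmd

open AugSearch

variable {n : ℕ} {G F : SimpleGraph (Fin n)} {A : Set (Fin n)} {v₀ : Fin n} {D : Finset (Fin n)}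
  {S : Fin n → SimpleGraph (Fin n)} {M M' : Memory}

lemma den_seq {p q : Cmd} : (seq p q).den M = q.den (p.den M) := rfl

/-- Making the first gain, if there is one. -/
def scanGain : Cmd := rep 2 (rep 3 tryGain)

/-- Making the first move, if there is one. -/
def scanMove (k : ℕ) : Cmd := rep 2 (rep 3 (rep 4 (rep 5 (tryMove k))))

lemma den_scanGain (hF : Start G A F v₀) (h : Ready G F v₀ D S M) (hs : State G A F v₀ D S) :
    ((∀ v p, ¬ Gain G D S v p) ∧ Ready G F v₀ D S (scanGain.den M)) ∨
      Progress G A F v₀ D (scanGain.den M) := by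
  refine den_rep_rep_search (c := 2) (d := 3) rfl rfl (by decide) (P := Gain G D S)
    (fun M x i hx h => h.tick (by omega) i) (fun M x i hx h => h.tick (by omega) i)
    (fun v p M hv hp h => den_tryGain hF h hs hv hp) (fun M h => ?_)
    (fun M h => h.rep.static.size) h
  rwa [tryGain, den_pick_of_ne (by rw [h.moved]; decide)]

lemma den_tryMove_of_progress (k : ℕ) (h : Progress G A F v₀ D M) :
    Progress G A F v₀ D ((tryMove k).den M) := by
  rwa [tryMove, den_pick_of_ne (by rw [h.moved]; decide)]

lemma den_rep_tryMove_of_progress (k : ℕ) (h : Progress G A F v₀ D M) :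
    Progress G A F v₀ D ((rep 4 (rep 5 (tryMove k))).den M) :=
  den_rep_of_inv rfl (fun _ i h => h.tick (by decide) i) (fun _ => den_rep_of_inv rfl
    (fun _ i h => h.tick (by decide) i) fun _ => den_tryMove_of_progress k) h

lemma den_scanMove_of_progress (k : ℕ) (h : Progress G A F v₀ D M) :
    Progress G A F v₀ D ((scanMove k).den M) :=
  den_rep_of_inv rfl (fun _ i h => h.tick (by decide) i) (fun _ => den_rep_of_inv rfl
    (fun _ i h => h.tick (by decide) i) fun _ => den_rep_tryMove_of_progress k) h

open Classical in
lemma den_scanMove {k : ℕ} (hk : k ≤ 1) (hA : ∀ u, u ∈ A ↔ dg G u = dg G v₀)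
    (hnext : ∀ v p q w, Move G A D S v p q w → (k ≠ 0 → (S v).Reachable v p) →
      Round G A F v₀ (insert w D) (Function.update S w (link (cut (S v) q w) v p)))
    (h : Ready G F v₀ D S M) :
    ((∀ v p q w, Move G A D S v p q w → ¬ (k ≠ 0 → (S v).Reachable v p)) ∧
      Ready G F v₀ D S ((scanMove k).den M)) ∨ Progress G A F v₀ D ((scanMove k).den M) := by
  have := den_rep_rep_search (c := 2) (d := 3) (p := rep 4 (rep 5 (tryMove k))) rfl rfl
    (by decide) (P := fun v p => ∃ q w, Move G A D S v p q w ∧ (k ≠ 0 → (S v).Reachable v p))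
    (R := Ready G F v₀ D S) (Q := Progress G A F v₀ D)
    (fun M x i hx h => h.tick (by omega) i) (fun M x i hx h => h.tick (by omega) i)
    ?_ (fun M => den_rep_tryMove_of_progress k) (fun M h => h.rep.static.size) h
  · exact this.imp_left fun h1 =>
      ⟨fun v p q w hm hr => h1.1 v p ⟨q, w, hm, hr⟩, h1.2⟩
  · intro v p M hv hp h
    have := den_rep_rep_search (c := 4) (d := 5) (p := tryMove k) rfl rfl (by decide)
      (P := fun q w => Move G A D S v p q w ∧ (k ≠ 0 → (S v).Reachable v p))
      (R := fun M : Memory => Ready G F v₀ D S M ∧ M 3 0 2 = v ∧ M 3 0 3 = p)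
      (Q := Progress G A F v₀ D) ?_ (fun M x i hx h => h.tick (by omega) i) ?_
      (fun M => den_tryMove_of_progress k) (fun M h => h.1.rep.static.size) ⟨h, hv, hp⟩
    · exact this.imp_left fun h1 => ⟨fun ⟨q, w, hm⟩ => h1.1 q w hm, h1.2.1⟩
    · rintro M x i hx ⟨h1, h2, h3⟩
      refine ⟨h1.tick (by omega) i, ?_, ?_⟩
      · rwa [Memory.write_eq, if_neg (by omega)]
      · rwa [Memory.write_eq, if_neg (by omega)]
    · rintro q w M hq hw ⟨h1, h2, h3⟩
      refine (den_tryMove hk hA hnext h1 h2 h3 hq hw).imp_left fun h4 => ⟨h4.1, h4.2, ?_, ?_⟩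
      · rw [den_of_not_counts _ rfl, h2]
      · rw [den_of_not_counts _ rfl, h3]

/-- A round of the search: a gain, or else a move inside a component, or else any move. -/
def round : Cmd :=
  guard (.eq (.get 13 (.lit 0) (.lit 0)) (.lit 0)) (seq (store 14 (.lit 0) (.lit 0) (.lit 0))
    (seq scanGain (seq (scanMove 1) (scanMove 0))))

/-- The memory after `k` rounds of the search. -/
structure Searching (G : SimpleGraph (Fin n)) (A : Set (Fin n)) (F : SimpleGraph (Fin n))
    (v₀ : Fin n) (k : ℕ) (M : Memory) : Prop where
  root : M 3 0 0 = v₀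
  result : (M 13 0 0 = 1 ∧ ∃ F', Gained G A F v₀ F' ∧ IsMat M 2 F') ∨
    (M 13 0 0 = 0 ∧ ∃ D' S', D'.card = k + 1 ∧ Rep G F D' S' M ∧ Round G A F v₀ D' S')

lemma Searching.tick {k : ℕ} (h : Searching G A F v₀ k M) {c : ℕ} (hc : c ≠ 0) (i : ℕ) :
    Searching G A F v₀ k (M.write 3 0 c i) := by
  refine ⟨?_, ?_⟩
  · rw [Memory.write_eq, if_neg (by simp [hc.symm])]; exact h.root
  · rw [Memory.write_of_ne (by decide : (13 : ℕ) ≠ 3)]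
    rcases h.result with ⟨h1, F', h2, h3⟩ | ⟨h1, D', S', h2, h3, h4⟩
    · exact Or.inl ⟨h1, F', h2, h3.congr (Memory.write_of_ne (by decide))⟩
    · exact Or.inr ⟨h1, D', S', h2, h3.tick c i, h4⟩

/-- The order of the scans supplies the hypotheses of `Round.step_of_reachable` and `Round.step`:
each scan may assume that the previous ones found nothing. If all fail, `hprog` is contradicted. -/
lemma den_round (hF : Start G A F v₀) (hA : ∀ u, u ∈ A ↔ dg G u = dg G v₀)
    (hprog : ∀ D S, Round G A F v₀ D S → (∀ v p, ¬ Gain G D S v p) →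
      ∃ v p q w, Move G A D S v p q w) {k : ℕ} (h : Searching G A F v₀ k M) :
    Searching G A F v₀ (k + 1) (round.den M) := by
  rcases h.result with ⟨h1, h2⟩ | ⟨h1, D, S, hcard, hrep, hround⟩
  · rw [round, den_guard_of_false (by simp [Test.eval, Expr.eval, h1])]
    exact ⟨h.root, Or.inl ⟨h1, h2⟩⟩
  rw [round, den_guard_of_true (by simp [Test.eval, Expr.eval, h1]), den_seq, den_seq, den_seq]
  have h0 : Ready G F v₀ D S ((store 14 (.lit 0) (.lit 0) (.lit 0)).den M) := by
    refine ⟨hrep.den _ rfl rfl, ?_, ?_, by simp [den, Memory.write, Expr.eval]⟩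
    · rw [den_of_not_counts _ rfl, h.root]
    · rw [den_of_not_writes (a := 13) _ rfl, h1]
  generalize (store 14 (.lit 0) (.lit 0) (.lit 0)).den M = M₁ at h0 ⊢
  suffices hP : Progress G A F v₀ D ((scanMove 0).den ((scanMove 1).den (scanGain.den M₁))) from
    ⟨hP.root, hcard ▸ hP.result⟩
  rcases den_scanGain hF h0 hround.state with ⟨hno, h2⟩ | h2
  swap
  · exact den_scanMove_of_progress 0 (den_scanMove_of_progress 1 h2)
  rcases den_scanMove (k := 1) le_rfl hA
    (fun v p q w hm hr => by convert hround.step_of_reachable hF hno hm (hr one_ne_zero)) h2 with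
    ⟨hint, h3⟩ | h3
  swap
  · exact den_scanMove_of_progress 0 h3
  have hint' : ∀ v p q w, Move G A D S v p q w → ¬ (S v).Reachable v p :=
    fun v p q w hm hr => hint v p q w hm fun _ => hr
  rcases den_scanMove (k := 0) zero_le_one hA
    (fun v p q w hm _ => by convert hround.step hF hno hint' hm) h3 with ⟨hall, -⟩ | h4
  · obtain ⟨v, p, q, w, hm⟩ := hprog D S hround hno
    exact absurd (fun h => absurd rfl h) (hall v p q w hm)
  · exact h4

/-- The search for an edge to be gained at counter `0`. -/
def search : Cmd :=
  seq (seq (clear 7) (store 7 (.lit 0) (ctr 0) (.lit 1))) (seq saveStart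
    (seq (store 13 (.lit 0) (.lit 0) (.lit 0)) (rep 1 round)))

/-- Without success, `n` rounds would leave a set of `n + 1` reached vertices. -/
theorem den_search (hF : Start G A F v₀) (hA : ∀ u, u ∈ A ↔ dg G u = dg G v₀)
    (hprog : ∀ D S, Round G A F v₀ D S → (∀ v p, ¬ Gain G D S v p) →
      ∃ v p q w, Move G A D S v p q w) (hs : Static G M) (h2 : IsMat M 2 F) (h0 : M 3 0 0 = v₀) :
    ∃ F', Gained G A F v₀ F' ∧ IsMat (search.den M) 2 F' := by
  classical
  rw [search, den, den, den]
  have hs1 := hs.den (seq (clear 7) (store 7 (.lit 0) (ctr 0) (.lit 1))) rfl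
  have h21 := h2.congr (den_of_not_writes (a := 2)
    (seq (clear 7) (store 7 (.lit 0) (ctr 0) (.lit 1))) rfl M)
  have h01 : (seq (clear 7) (store 7 (.lit 0) (ctr 0) (.lit 1))).den M 3 0 0 = v₀ := by
    rw [den_of_not_counts (c := 0) _ rfl, h0]
  have hflag : ∀ v : Fin n, (seq (clear 7) (store 7 (.lit 0) (ctr 0) (.lit 1))).den M 7 0 v =
      if v ∈ ({v₀} : Finset (Fin n)) then 1 else 0 := by
    intro v
    have hc := den_clear (a := 7) hs.size (by decide) (by decide) ⟨0, v.pos⟩ v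
    have hc0 : (clear 7).den M 3 0 0 = v₀ := by rw [den_of_not_counts (c := 0) _ rfl, h0]
    simp only [den, Expr.eval, hc0, Memory.write_eq, Finset.mem_singleton, Fin.val_inj, true_and]
    split_ifs
    · rfl
    · exact hc
  generalize (seq (clear 7) (store 7 (.lit 0) (ctr 0) (.lit 1))).den M = M₁ at hs1 h21 h01 hflag ⊢
  have hrow := den_saveStart hs1.size hs1.code h21
  rw [h01] at hrow
  have hrep : Rep G F {v₀} (fun _ => F) (saveStart.den M₁) := by
    refine ⟨hs1.den saveStart rfl, h21.congr (den_of_not_writes (a := 2) saveStart rfl M₁), ?_, ?_⟩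
    · rw [den_of_not_writes (a := 7) saveStart rfl]; exact hflag
    · intro v hv
      rw [Finset.mem_singleton.1 hv]
      exact hrow
  have h02 : saveStart.den M₁ 3 0 0 = v₀ := by rw [den_of_not_counts (c := 0) saveStart rfl, h01]
  generalize saveStart.den M₁ = M₂ at hrep h02 ⊢
  have hstart : Searching G A F v₀ 0 ((store 13 (.lit 0) (.lit 0) (.lit 0)).den M₂) := by
    refine ⟨?_, Or.inr ⟨by simp [den, Memory.write, Expr.eval], {v₀}, fun _ => F, by simp,
      hrep.den _ rfl rfl, Round.init hF rfl⟩⟩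
    rw [den_of_not_counts (c := 0) _ rfl, h02]
  have hn3 : (store 13 (.lit 0) (.lit 0) (.lit 0)).den M₂ 1 0 0 = n := by
    rw [den_of_not_writes (a := 1) _ rfl, hrep.static.size]
  have main := den_rep (c := 1) (p := round) rfl (Searching G A F v₀) hn3
    (hstart.tick (by decide) 0)
    fun i _ M _ h => (den_round hF hA hprog h).tick (by decide) _
  rcases main.result with ⟨-, h⟩ | ⟨-, D, S, hcard, -⟩
  · exact h
  · have := Finset.card_le_univ D
    rw [Fintype.card_fin] at this
    omega

/-- Setting up the codes of pairs. -/
def codeTable : Cmd :=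
  rep 6 (rep 7 (seq (store 5 (ctr 6) (ctr 7) (.get 12 (.lit 0) (.lit 0)))
    (store 12 (.lit 0) (.lit 0) (.succ (.get 12 (.lit 0) (.lit 0))))))

/-- The code of `(i, j)` is `i * n + j`, produced by a running counter because the machine cannot
multiply. Codes let a whole graph fit into one row of array `6`. -/
lemma den_codeTable (hn : M 1 0 0 = n) (h12 : M 12 0 0 = 0) : IsCode n (codeTable.den M) := by
  have key := den_rep (c := 6) (n := n)
    (p := rep 7 (seq (store 5 (ctr 6) (ctr 7) (.get 12 (.lit 0) (.lit 0)))
      (store 12 (.lit 0) (.lit 0) (.succ (.get 12 (.lit 0) (.lit 0)))))) rfl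
    (fun i M => M 1 0 0 = n ∧ M 12 0 0 = i * n ∧ ∀ i' < i, ∀ j < n, M 5 i' j = i' * n + j) hn
    ⟨hn, by rw [Memory.write_of_ne (by decide), h12, zero_mul], by simp⟩ ?_
  · intro i hi j hj i' hi' j' hj' heq
    have h1 := key.2.2 i hi j hj
    have h2 := key.2.2 i' hi' j' hj'
    change codeTable.den M 5 i j = _ at h1
    change codeTable.den M 5 i' j' = _ at h2
    rw [h1, h2] at heq
    have hpos : 0 < n := by omega
    have hj1 : j = j' := by
      have := congrArg (· % n) heq
      simpa [Nat.mod_eq_of_lt hj, Nat.mod_eq_of_lt hj'] using this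
    subst hj1
    exact ⟨Nat.eq_of_mul_eq_mul_right hpos (Nat.add_right_cancel heq), rfl⟩
  · rintro i hi M h6 ⟨g1, g2, g3⟩
    have inner := den_rep (c := 7) (n := n)
      (p := seq (store 5 (ctr 6) (ctr 7) (.get 12 (.lit 0) (.lit 0)))
        (store 12 (.lit 0) (.lit 0) (.succ (.get 12 (.lit 0) (.lit 0))))) rfl
      (fun j M => M 1 0 0 = n ∧ M 3 0 6 = i ∧ M 12 0 0 = i * n + j ∧
        (∀ i' < i, ∀ j < n, M 5 i' j = i' * n + j) ∧ ∀ j' < j, M 5 i j' = i * n + j') g1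
      ⟨g1, by rw [Memory.write_eq, if_neg (by simp)]; exact h6, g2, g3, by simp⟩ ?_
    · obtain ⟨f1, -, f3, f4, f5⟩ := inner
      refine ⟨f1, by rw [Memory.write_of_ne (by decide), f3]; ring, fun i' hi' j hj => ?_⟩
      rw [Memory.write_of_ne (by decide)]
      rcases Nat.lt_succ_iff_lt_or_eq.1 hi' with hlt | rfl
      · exact f4 i' hlt j hj
      · exact f5 j hj
    · rintro j hj M h7 ⟨f1, f2, f3, f4, f5⟩
      have hw : (seq (store 5 (ctr 6) (ctr 7) (.get 12 (.lit 0) (.lit 0)))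
          (store 12 (.lit 0) (.lit 0) (.succ (.get 12 (.lit 0) (.lit 0))))).den M =
          (M.write 5 i j (i * n + j)).write 12 0 0 (i * n + j + 1) := by
        simp [den, Expr.eval, f2, h7, f3, Memory.write_of_ne]
      rw [hw]
      refine ⟨f1, ?_, ?_, fun i' hi' j' hj' => ?_, fun j' hj' => ?_⟩
      · rw [Memory.write_eq, if_neg (by simp)]; exact f2
      · rw [Memory.write_of_ne (by decide), Memory.write_eq, if_pos ⟨rfl, rfl⟩, add_assoc]
      · rw [Memory.write_of_ne (by decide), Memory.write_of_ne (by decide), Memory.write_eq,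
          if_neg (by omega)]
        exact f4 i' hi' j' hj'
      · rw [Memory.write_of_ne (by decide), Memory.write_of_ne (by decide), Memory.write_eq]
        split_ifs with he
        · rw [he.2]
        · exact f5 j' (by omega)

/-- Setting up the table of degrees. -/
def degreeTable : Cmd :=
  rep 0 (seq (count 0 0) (store 10 (.lit 0) (ctr 0) (.get 12 (.lit 0) (.lit 0))))

lemma den_degreeTable (hn : M 1 0 0 = n) (h : IsMat M 0 G) (v : Fin n) :
    degreeTable.den M 10 0 v = dg G v := by
  have key := den_rep (c := 0) (n := n)
    (p := seq (count 0 0) (store 10 (.lit 0) (ctr 0) (.get 12 (.lit 0) (.lit 0)))) rfl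
    (fun i M => M 1 0 0 = n ∧ IsMat M 0 G ∧ ∀ u : Fin n, u.1 < i → M 10 0 u = dg G u) hn
    ⟨hn, h, by simp⟩ ?_
  · exact key.2.2 v v.2
  · rintro i hi M h0 ⟨g1, g2, g3⟩
    have h12 := den_count g1 (a := 0) (c := 0) (by decide) (by decide) (by decide) g2
      (v := ⟨i, hi⟩) h0
    have hc0 : (count 0 0).den M 3 0 0 = i := by rw [den_of_not_counts (c := 0) _ rfl, h0]
    have h10 := den_of_not_writes (a := 10) (count 0 0) rfl M
    refine ⟨?_, g2.congr ?_, fun u hu => ?_⟩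
    · rw [Memory.write_of_ne (by decide), den_of_not_writes (a := 1) _ rfl, g1]
    · rw [Memory.write_of_ne (by decide), den_of_not_writes (a := 0) _ rfl]
    · rw [Memory.write_of_ne (by decide)]
      simp only [den, Expr.eval, hc0, h12, Memory.write_eq, true_and, h10]
      split_ifs with he
      · rw [show u = ⟨i, hi⟩ from Fin.ext he]
      · exact g3 u (by omega)

/-- One edge at each vertex of degree three. -/
def phaseThree : Cmd := rep 0 (guard (.eq (.get 10 (.lit 0) (ctr 0)) (.lit 3)) search)

/-- One more edge at each vertex of degree four that has not got two. -/
def phaseFour : Cmd :=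
  rep 0 (guard (.eq (.get 10 (.lit 0) (ctr 0)) (.lit 4))
    (seq (count 2 0) (guard (.lt (.get 12 (.lit 0) (.lit 0)) (.lit 2)) search)))

/-- The invariant fixes the degrees at the vertices of degree 3 exactly: one at those treated, zero
at the others. The search used here needs degree at most one on `A` and zero at `v₀`. -/
lemma den_phaseThree (hG : ∀ v, dg G v = 3 ∨ dg G v = 4)
    (hbip : ∀ ⦃u v⦄, G.Adj u v → (dg G u = 3 ↔ dg G v ≠ 3)) (hs : Static G M)
    (h2 : IsMat M 2 (⊥ : SimpleGraph (Fin n))) :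
    ∃ F, IsMat (phaseThree.den M) 2 F ∧ F ≤ G ∧ IsLinForest F ∧ ∀ u, dg G u = 3 → 1 ≤ dg F u := by
  have key := den_rep (c := 0) (n := n)
    (p := guard (.eq (.get 10 (.lit 0) (ctr 0)) (.lit 3)) search) rfl
    (fun i M => Static G M ∧ ∃ F, IsMat M 2 F ∧ F ≤ G ∧ IsLinForest F ∧
      ∀ u : Fin n, dg G u = 3 → dg F u = if u.1 < i then 1 else 0) hs.size
    ⟨hs.tick 0 0, ⊥, h2.congr (Memory.write_of_ne (by decide)), bot_le, ?_, ?_⟩ ?_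
  · obtain ⟨-, F, g1, g2, g3, g4⟩ := key
    exact ⟨F, g1, g2, g3, fun u hu => by rw [g4 u hu, if_pos u.2]⟩
  · exact ⟨SimpleGraph.isAcyclic_bot, fun v => by simp [dg, nbrs]⟩
  · simp [dg, nbrs]
  · rintro i hi M h0 ⟨hs, F, g1, g2, g3, g4⟩
    refine ⟨(hs.den _ rfl).tick _ _, ?_⟩
    refine den_guard (R := fun M' : Memory => ∃ F, IsMat (M'.write 3 0 0 (i + 1)) 2 F ∧ F ≤ G ∧
      IsLinForest F ∧ ∀ u : Fin n, dg G u = 3 → dg F u = if u.1 < i + 1 then 1 else 0)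
      (X := dg G ⟨i, hi⟩ = 3) (eval_eq.trans ?_) (fun h3 => ?_) fun h3 => ?_
    · simp only [Expr.eval, h0]
      rw [hs.deg ⟨i, hi⟩]
    · refine ⟨F, g1.congr (Memory.write_of_ne (by decide)), g2, g3, fun u hu => ?_⟩
      have hne : u.1 ≠ i := by
        rintro rfl
        exact h3 hu
      rw [g4 u hu]
      split_ifs <;> first | rfl | omega
    · have hd0 : dg F ⟨i, hi⟩ = 0 := by rw [g4 _ h3, if_neg (by simp)]
      have hF : Start G {u | dg G u = dg G ⟨i, hi⟩} F ⟨i, hi⟩ :=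
        ⟨fun u v huv => by simpa only [Set.mem_ofPred_eq, h3] using hbip huv, g2, g3, rfl, by omega⟩
      obtain ⟨F', f1, f2⟩ := den_search hF (fun u => Iff.rfl) (fun D S hr hno =>
        hr.state.exists_of_degree_three hF (fun v hv => hv.trans h3)
          (fun v hv => (hG v).resolve_left fun h => hv (h.trans h3.symm))
          (fun v hv => by rw [g4 v (hv.trans h3)]; split_ifs <;> simp) hd0 hno) hs g1 h0
      refine ⟨F', f2.congr (Memory.write_of_ne (by decide)), f1.le, f1.forest, fun u hu => ?_⟩
      rw [f1.deg_mem u (hu.trans h3.symm), g4 u hu]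
      by_cases hui : u = ⟨i, hi⟩
      · subst hui; simp
      · have : u.1 ≠ i := fun he => hui (Fin.ext he)
        rw [if_neg hui]
        split_ifs <;> first | rfl | omega

/-- One run raises the guaranteed degree from `d` to `d + 1`; it is applied with `d = 0` and then `d
= 1`. Edges at vertices of degree 3 may be rerouted, but `Gained.deg_notMem` leaves each of them at
least one. -/
lemma den_phaseFour (hG : ∀ v, dg G v = 3 ∨ dg G v = 4)
    (hbip : ∀ ⦃u v⦄, G.Adj u v → (dg G u = 3 ↔ dg G v ≠ 3)) (hs : Static G M)
    (h2 : IsMat M 2 F) (hle : F ≤ G) (hF : IsLinForest F) (h3 : ∀ u, dg G u = 3 → 1 ≤ dg F u)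
    {d : ℕ} (hd : d ≤ 1) (h4 : ∀ u, dg G u = 4 → d ≤ dg F u) :
    ∃ F, IsMat (phaseFour.den M) 2 F ∧ F ≤ G ∧ IsLinForest F ∧ (∀ u, dg G u = 3 → 1 ≤ dg F u) ∧
      ∀ u, dg G u = 4 → d + 1 ≤ dg F u := by
  have key := den_rep (c := 0) (n := n)
    (p := guard (.eq (.get 10 (.lit 0) (ctr 0)) (.lit 4))
      (seq (count 2 0) (guard (.lt (.get 12 (.lit 0) (.lit 0)) (.lit 2)) search))) rfl
    (fun i M => Static G M ∧ ∃ F, IsMat M 2 F ∧ F ≤ G ∧ IsLinForest F ∧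
      (∀ u, dg G u = 3 → 1 ≤ dg F u) ∧
      ∀ u : Fin n, dg G u = 4 → d ≤ dg F u ∧ (u.1 < i → d + 1 ≤ dg F u)) hs.size
    ⟨hs.tick 0 0, F, h2.congr (Memory.write_of_ne (by decide)), hle, hF, h3,
      fun u hu => ⟨h4 u hu, by simp⟩⟩ ?_
  · obtain ⟨-, F, g1, g2, g3, g4, g5⟩ := key
    exact ⟨F, g1, g2, g3, g4, fun u hu => (g5 u hu).2 u.2⟩
  · rintro i hi M h0 ⟨hs, F, g1, g2, g3, g4, g5⟩
    refine ⟨(hs.den _ rfl).tick _ _, ?_⟩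
    let R : Memory → Prop := fun M' => ∃ F, IsMat (M'.write 3 0 0 (i + 1)) 2 F ∧ F ≤ G ∧
      IsLinForest F ∧ (∀ u, dg G u = 3 → 1 ≤ dg F u) ∧
      ∀ u : Fin n, dg G u = 4 → d ≤ dg F u ∧ (u.1 < i + 1 → d + 1 ≤ dg F u)
    change R _
    refine den_guard (X := dg G ⟨i, hi⟩ = 4) (eval_eq.trans ?_) (fun h4 => ?_) fun h4 => ?_
    · simp only [Expr.eval, h0]
      rw [hs.deg ⟨i, hi⟩]
    · refine ⟨F, g1.congr (Memory.write_of_ne (by decide)), g2, g3, g4, fun u hu =>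
        ⟨(g5 u hu).1, fun hui => (g5 u hu).2 ?_⟩⟩
      have hne : u.1 ≠ i := by
        rintro rfl
        exact h4 hu
      omega
    have h12 := den_count hs.size (a := 2) (c := 0) (by decide) (by decide) (by decide) g1
      (v := ⟨i, hi⟩) h0
    have hs1 := hs.den (count 2 0) rfl
    have h01 : (count 2 0).den M 3 0 0 = i := by rw [den_of_not_counts (c := 0) _ rfl, h0]
    have g11 := g1.congr (den_of_not_writes (a := 2) (count 2 0) rfl M)
    rw [den]
    generalize (count 2 0).den M = M₁ at h12 hs1 h01 g11 ⊢
    refine den_guard (X := dg F ⟨i, hi⟩ < 2) (eval_lt.trans ?_) (fun h5 => ?_) fun h5 => ?_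
    · simp only [Expr.eval, h12]
    -- A skipped vertex has two edges already, which is enough because `d ≤ 1`.
    · refine ⟨F, g11.congr (Memory.write_of_ne (by decide)), g2, g3, g4, fun u hu =>
        ⟨(g5 u hu).1, fun hui => ?_⟩⟩
      by_cases he : u = ⟨i, hi⟩
      · subst he; omega
      · have : u.1 ≠ i := fun h => he (Fin.ext h)
        exact (g5 u hu).2 (by omega)
    have hF : Start G {u | dg G u = dg G ⟨i, hi⟩} F ⟨i, hi⟩ := by
      refine ⟨fun u v huv => ?_, g2, g3, rfl, by omega⟩
      have h6 := hbip huv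
      have h7 := hG u
      have h8 := hG v
      simp only [Set.mem_ofPred_eq, h4]
      omega
    have hA3 : ∀ v, dg G v = 3 ↔ v ∉ {u | dg G u = dg G ⟨i, hi⟩} := by
      intro v
      have := hG v
      simp only [Set.mem_ofPred_eq, h4]
      omega
    obtain ⟨F', f1, f2⟩ := den_search hF (fun u => Iff.rfl) (fun D S hr hno =>
      hr.exists_of_degree_four hF (fun v hv => hv.trans h4) (fun v hv => (hA3 v).2 hv) hno)
      hs1 g11 h01
    refine ⟨F', f2.congr (Memory.write_of_ne (by decide)), f1.le, f1.forest,
      fun u hu => f1.deg_notMem u ((hA3 u).1 hu) (g4 u hu), fun u hu => ?_⟩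
    have h6 := f1.deg_mem u (hu.trans h4.symm)
    have h7 := g5 u hu
    by_cases he : u = ⟨i, hi⟩
    · rw [if_pos he] at h6
      omega
    · have : u.1 ≠ i := fun h => he (Fin.ext h)
      rw [if_neg he] at h6
      exact ⟨by omega, fun hui => by have := h7.2 (by omega); omega⟩

/-- The construction of a path factor. -/
def pathFactor : Cmd :=
  seq (seq codeTable degreeTable) (seq phaseThree (seq phaseFour phaseFour))

theorem pathFactor_correct (hG : IsBiregularBigraph 3 4 G) :
    ∃ F, IsMat (pathFactor.den (graphInput G)) 2 F ∧ IsWanted G F := by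
  obtain ⟨hdeg, hbip⟩ := hG.dg_eq
  have hn : graphInput G 1 0 0 = n := by simp [graphInput]
  have h0 : IsMat (graphInput G) 0 G := fun i j => by
    by_cases h : G.Adj i j <;> simp [graphInput, h]
  have h2 : IsMat (graphInput G) 2 (⊥ : SimpleGraph (Fin n)) := fun i j => by simp [graphInput]
  have hs : Static G ((seq codeTable degreeTable).den (graphInput G)) := by
    refine ⟨?_, ?_, fun v => ?_, ?_⟩
    · rw [den_of_not_writes (a := 1) _ rfl, hn]
    · exact h0.congr (den_of_not_writes (a := 0) _ rfl _)
    · rw [den]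
      refine den_degreeTable ?_ (h0.congr ?_) v
      · rw [den_of_not_writes (a := 1) _ rfl, hn]
      · exact den_of_not_writes (a := 0) _ rfl _
    · have := den_codeTable hn (by simp [graphInput])
      unfold IsCode
      rw [den, den_of_not_writes (a := 5) degreeTable rfl]
      exact this
  have h21 := h2.congr (den_of_not_writes (a := 2) (seq codeTable degreeTable) rfl (graphInput G))
  rw [pathFactor, den, den, den]
  generalize (seq codeTable degreeTable).den (graphInput G) = M₁ at hs h21 ⊢
  obtain ⟨F₁, a1, a2, a3, a4⟩ := den_phaseThree hdeg hbip hs h21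
  obtain ⟨F₂, b1, b2, b3, b4, b5⟩ := den_phaseFour hdeg hbip (hs.den phaseThree rfl) a1 a2 a3 a4
    zero_le_one fun u _ => Nat.zero_le _
  obtain ⟨F₃, c1, c2, c3, c4, c5⟩ := den_phaseFour hdeg hbip
    ((hs.den phaseThree rfl).den phaseFour rfl) b1 b2 b3 b4 le_rfl b5
  refine ⟨F₃, c1, c2, c3, fun v => ?_, fun v hv => ?_⟩
  · rcases hdeg v with h3 | h4
    · exact c4 v h3
    · exact one_le_two.trans (c5 v h4)
  · exact le_antisymm (c3.dg_le v) (c5 v hv)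

end Cmd

end ArrayMachine

theorem theorem3 :
    (∀ (V : Type*) [Finite V] (G : SimpleGraph V), IsBiregularBigraph 3 4 G →
      ∃ F : SimpleGraph V, IsPathFactor G F ∧ PathEndpointsHaveDegree 3 G F) ∧
    ArrayMachine.PolyTimeConstructible
      (fun {_} G => IsBiregularBigraph 3 4 G)
      (fun {_} G F => IsPathFactor G F ∧ PathEndpointsHaveDegree 3 G F) := by
  refine ⟨fun V _ G hG => ?_, ArrayMachine.Cmd.pathFactor.toProgram,
    ArrayMachine.Cmd.pathFactor.cost, fun n G hG => ?_⟩
  · have := Fintype.ofFinite V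
    have e := Fintype.equivFin V
    -- Existence is obtained by running the program on a copy of `G` with vertices numbered, and
    -- transporting the result back.
    obtain ⟨F, -, hF⟩ := ArrayMachine.Cmd.pathFactor_correct (hG.comap e.symm)
    exact ⟨F.comap e, (hF.comap e).isPathFactor hG.dg_eq.1⟩
  · obtain ⟨F, h2, hF⟩ := ArrayMachine.Cmd.pathFactor_correct hG
    have hrun := (ArrayMachine.Cmd.runs ArrayMachine.Cmd.pathFactor rfl
      (ArrayMachine.graphInput G)).haltsWithin
    rw [show ArrayMachine.graphInput G 1 0 0 = n by simp [ArrayMachine.graphInput]] at hrun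
    exact ⟨_, F, hrun, h2, hF.isPathFactor hG.dg_eq.1⟩
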